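/- **Setting.** The *basic types* are the integers and the booleans; the other types are *algebraic data types* (ADTs), freely generated by declared constructors, and each of them is non-empty. A *constraint* is a quantifier-free formula of linear integer arithmetic and booleans; $\mathbb D$ is its standard interpretation. An *atom* $p(t_1,\dots,t_m)$ consists of a predicate symbol and typed terms built from variables and constructors, where every (sub)term of basic type is a variable. A *clause* $H\leftarrow c,G$ has a head $H$ (an atom, or $\mathit{false}$, in which case the clause is a *goal*; otherwise it is *definite*), a constraint $c$ and a finite conjunction $G$ of atoms, up to the order of the atoms. A *variant* of a clause is obtained by renaming its variables. A *$\mathbb D$-interpretation* assigns relations over the integers, the booleans and the elements of the ADTs to the predicate symbols; a set of clauses is *satisfiable* if all its clauses (universally quantified) are true in some $\mathbb D$-interpretation. For a set $P$ of definite clauses, $M(P)$ is the set of the ground atoms true in all its models. For a set of variables or a formula, $\mathit{bvars}$ and $\mathit{adt\text{-}vars}$ denote its variables of basic and of ADT type. If $F$ is a conjunction of atoms and $\mathit{vars}(F)=X\cup Y$ with $X,Y$ disjoint, $F(X,Y)$ is *functional* from $X$ to $Y$ with respect to $P$ if $M(P)\models\forall X,Y,Z.\,F(X,Y)\wedge F(X,Z)\to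 Y=Z$, and *total* if $M(P)\models\forall X\exists Y.\,F(X,Y)$; $F(X;Y)$ denotes a total, functional conjunction. **Algorithm $\mathcal R$.** The input is a set $\mathit{Cls}=\mathit{Ds}\cup\mathit{Gs}$ of clauses ($\mathit{Ds}$ definite clauses, $\mathit{Gs}$ goals) and a level mapping $\ell$ from predicates to $\mathbb N$ (by convention $\ell(\mathit{false})$ exceeds all levels). Fixed parameters are: a designation of the input arguments of each predicate (the *input variables* of an atom are those in its input arguments, the other ones are its *output variables*); a *generalization* operator $\alpha$ with $\mathbb D\models\forall(c_1\to\alpha(c_1,c_2))$ and $\mathbb D\models\forall(c_2\to\alpha(c_1,c_2))$; a *projection* operator $\pi$ with $\mathit{vars}(\pi(c,V))\subseteq V$ and $\mathbb D\models\forall(c\to\pi(c,V))$; and a well-founded ordering $\prec$ on tuples of terms that is closed under substitution. Start with $\mathit{InCls}=\mathit{Gs}$, $\mathit{Defs}=\mathit{TransfCls}=\emptyset$. While $\mathit{InCls}\neq\emptyset$, execute in turn procedures (1)–(3) below, then set $\mathit{InCls}:=\mathit{RCls}$, $\mathit{Defs}:=\mathit{Defs}\cup\mathit{NewDefs}$,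 $\mathit{TransfCls}:=\mathit{TransfCls}\cup\mathit{FldCls}$. The algorithm is nondeterministic; the output of a terminating run is the final $\mathit{TransfCls}$. *Introducing* a definition $p(U)\leftarrow c,B$ requires that $p$ is a new predicate, that the predicates of $B$ occur in $\mathit{Cls}$, and that the distinct variables $U$ occur in $c,B$; $\ell(p)$ is the maximal level of the atoms of $B$. An atom *has basic types* if all its arguments have basic types, and *has ADTs* otherwise; a clause has basic types if all its atoms do. The *sharing blocks* of a conjunction are the classes of its atoms under the reflexive, transitive closure of sharing an ADT variable; a non-empty conjunction is *connected* if it has one sharing block. (1) *Diff-Define-Fold* starts with $\mathit{NewDefs}=\mathit{FldCls}=\emptyset$ and processes the clauses $C$ of $\mathit{InCls}$ until none is left. If $C$ has basic types, it is moved to $\mathit{FldCls}$. Otherwise write $C$ as $H\leftarrow c,B,G'$, where $B$ is a sharing block of the body containing an atom that has ADTs, and replace $C$ in $\mathit{InCls}$ by the clause $E$ obtained by the first applicable case. Below, $D$: $\mathit{newp}(U)\leftarrow d,B'$ ranges over the variants of clauses of $\mathit{Defs}\cup\mathit{NewDefs}$ with $U=\mathit{bvars}(\{d,B'\})$, and $\vartheta$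 over the substitutions acting on $\mathit{adt\text{-}vars}(B')$ only. - *Fold*: $B=B'\vartheta$ and $\mathbb D\models\forall(c\to d)$ for some $D,\vartheta$. Fold $C$ using $D$: $E$ is $H\leftarrow c,\mathit{newp}(U),G'$. - *Generalize*: $B=B'\vartheta$ and $\mathbb D\not\models\forall(c\to d)$ for some $D,\vartheta$. Introduce $\mathit{GenD}$: $\mathit{genp}(U)\leftarrow\alpha(d,c),B'$ and fold $C$ using it: $E$ is $H\leftarrow c,\mathit{genp}(U),G'$. - *Diff-Introduce*: for some $D$, each atom of $B'$ has an instance in $B$ (separately chosen substitutions, distinct atoms of $B$ for distinct atoms of $B'$), and there are $\vartheta$ and a connected $M$ such that $B=(M,F(X;Y))$ with $F$ non-empty, $B'\vartheta=(M,R(V;W))$, $W\cap\mathit{vars}(C)=\emptyset$, and $\ell(H)>\ell(A)$ for every atom $A$ of $F$; here totality and functionality of $F(X;Y)$ and $R(V;W)$ are with respect to $\mathit{Ds}$ together with the definitions introduced so far, and $M$ is taken maximal. Introduce $\widehat D$: $\mathit{diff}(Z)\leftarrow\pi(c,X),F(X;Y),R(V;W)$ with $Z=\mathit{bvars}(\{F,R\})$;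 by *differential replacement* derive $C'$: $H\leftarrow c,M,R(V;W),\mathit{diff}(Z),G'$. If $\mathbb D\models\forall(c\to d)$, fold $C'$ using $D$: $E$ is $H\leftarrow c,\mathit{newp}(U),\mathit{diff}(Z),G'$. Otherwise introduce $\mathit{GenD}$: $\mathit{genp}(U)\leftarrow\alpha(d,c),B'$ and fold $C'$ using it: $E$ is $H\leftarrow c,\mathit{genp}(U),\mathit{diff}(Z),G'$. - *Project*: otherwise, introduce $\mathit{newp}(U)\leftarrow\pi(c,Z),B$ with $U=\mathit{bvars}(B)$ and $Z$ the set of the basic variables of $B$ that are input variables of some atom of $B$ and output variables of none, and fold $C$ using it: $E$ is $H\leftarrow c,\mathit{newp}(U),G'$. New definitions are added to $\mathit{NewDefs}$. (2) *Unfold* transforms $\mathit{NewDefs}$ into $\mathit{UnfCls}$. Unfolding a clause $H\leftarrow c,G,A$ with respect to $A$ replaces it by the clauses $(H\leftarrow c,d,G,B)\vartheta$, one for each clause $K\leftarrow d,B$ of $\mathit{Ds}$ (renamed apart) such that $A$ and $K$ have a most general unifier $\vartheta$ and $(c,d)\vartheta$ is satisfiable; in these, repeated occurrences of a basic variable in an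 atom may be replaced by new variables constrained to be equal to it. Marks are inherited by the atoms of $G$; the atoms of $B$ are unmarked. Phase 1: in each clause of $\mathit{NewDefs}$, with head $H$, mark a set $S$ of body atoms that contains an atom $A$ with $\ell(A)=\ell(H)$, whose other atoms are source atoms, and in which every source variable of the body occurs (a *source variable* of a conjunction is an input variable of some atom and an output variable of none; a *source atom* is one all of whose input variables are source variables); then unfold with respect to marked atoms until there are none. Phase 2: mark all body atoms; then, as long as possible, unfold with respect to atoms $A$ that are head-instances and are marked or descending. $A$ is a *head-instance* if each most general unifier as above is a variable renaming on the input variables of $A$; $A$ is *descending* if in every clause of $\mathit{Ds}$ whose head $K$ has the predicate $p$ of $A$, the tuple of input arguments of each body atom whose predicate depends on $p$ in $\mathit{Ds}$ is $\prec$ that of $K$. (3) *Replace* transforms $\mathit{UnfCls}$ into $\mathit{RCls}$ by a loop, each pass of which applies in turn, where possible, the following rules once each, until none of them is applicable: *deletion* of a clause with an unsatisfiable constraint; *functionality*, which replaces a clause $H\leftarrow c,F(X,Y),F(X,Z),G$, with $F$ non-empty and functional from $X$ to $Y$ with respect to $\mathit{RCls}\cup\mathit{Ds}$, by $H\leftarrow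 c,Y=Z,F(X,Y),G$ (equations between ADT variables being solved by a most general unifier); *totality*, which replaces $H\leftarrow c,F(X,Y),G$, with $F$ non-empty and total from $X$ to $Y$ with respect to $\mathit{RCls}\cup\mathit{Ds}$ and $Y\cap\mathit{vars}(H\leftarrow c,G)=\emptyset$, by $H\leftarrow c,G$. **Condition (E)** on folding $H\leftarrow c,B\vartheta,G$ using $K\leftarrow d,B$: for every variable $X\in\mathit{vars}(\{d,B\})\setminus\mathit{vars}(K)$, $X\vartheta$ is a variable that does not occur in $\{H,c,G\}$, nor in $Y\vartheta$ for any variable $Y\neq X$ of $(d,B)$. **Condition (F)** on the differential replacement of $F(X;Y)$ in $H\leftarrow c,F(X;Y),G$ using $\mathit{diff}(Z)\leftarrow d,F(X;Y),R(V;W)$: $\mathit{diff}(Z)$ is functional from $\mathit{bvars}(X\cup V)\cup\mathit{bvars}(W)$ to $\mathit{bvars}(Y)$ with respect to $\mathit{Ds}$ together with all the definitions introduced so far; $Y\cap(V\cup\mathit{vars}(d))=\emptyset$; and $\mathit{adt\text{-}vars}(Y)\cap\mathit{adt\text{-}vars}(\{H,c,G\})=\emptyset$. **Theorem (Completeness of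 Algorithm $\mathcal R$).** Suppose that a run of Algorithm $\mathcal R$ on the input set $\mathit{Cls}$ of clauses terminates with output $\mathit{TransfCls}$, that all foldings performed in the run fulfill Condition (E), and that all differential replacements performed in the run fulfill Condition (F). If $\mathit{Cls}$ is satisfiable, then $\mathit{TransfCls}$ is satisfiable. -/

import Mathlib

noncomputable section

namespace CHC

/-! ### Typed language: types, terms, ground values -/

/-- The types: the basic types `int` and `bool`, and the algebraic data types (ADTs). -/
inductive Ty (Adt : Type) : Type
  | int : Ty Adt
  | bool : Ty Adt
  | adt (a : Adt) : Ty Adt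

/-- The basic types are the integers and the booleans. -/
def Ty.IsBasic {Adt : Type} : Ty Adt → Prop
  | .int => True
  | .bool => True
  | .adt _ => False

/-- Data type declarations (each constructor has a list of argument types and an ADT as its
result type), together with a set of typed predicate symbols. -/
structure Signature where
  Adt : Type
  Con : Type
  conArgs : Con → List (Ty Adt)
  conRes : Con → Adt
  Pred : Type
  predArgs : Pred → List (Ty Adt)

abbrev Signature.Srt (S : Signature) : Type := Ty S.Adt

/-- Typed terms that may occur in atoms. Every term (and subterm) of basic type is a variable. -/
inductive Term (S : Signature) : S.Srt → Type
  | var {s : S.Srt} (x : ℕ) : Term S s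
  | con (k : S.Con) (args : ∀ i : Fin (S.conArgs k).length, Term S ((S.conArgs k).get i)) :
      Term S (.adt (S.conRes k))

/-- The values of each type: integers, booleans, and the freely generated elements of the ADTs
(ground constructor terms over integers and booleans). -/
inductive Value (S : Signature) : S.Srt → Type
  | int (n : ℤ) : Value S .int
  | bool (b : Bool) : Value S .bool
  | con (k : S.Con) (args : ∀ i : Fin (S.conArgs k).length, Value S ((S.conArgs k).get i)) :
      Value S (.adt (S.conRes k))

/-- Typed variables. -/
structure Var (S : Signature) where
  ty : S.Srt
  idx : ℕ

variable {S : Signature}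

/-- Substitutions (type preserving). Variables of basic type are mapped to variables. -/
abbrev Subst (S : Signature) : Type := ∀ s : S.Srt, ℕ → Term S s

abbrev Valuation (S : Signature) : Type := ∀ s : S.Srt, ℕ → Value S s

def Term.vars : {s : S.Srt} → Term S s → Set (Var S)
  | s, .var x => {⟨s, x⟩}
  | _, .con _ args => ⋃ i, (args i).vars

def Term.subst (θ : Subst S) : {s : S.Srt} → Term S s → Term S s
  | s, .var x => θ s x
  | _, .con k args => .con k (fun i => (args i).subst θ)

def Term.eval (σ : Valuation S) : {s : S.Srt} → Term S s → Value S s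
  | s, .var x => σ s x
  | _, .con k args => .con k (fun i => (args i).eval σ)

open Classical in
/-- Number of occurrences of a variable in a term. -/
def Term.occ (v : Var S) : {s : S.Srt} → Term S s → ℕ
  | s, .var x => if (⟨s, x⟩ : Var S) = v then 1 else 0
  | _, .con _ args => ∑ i, (args i).occ v

def Term.intIdx : Term S .int → ℕ
  | .var x => x

def Term.boolIdx : Term S .bool → ℕ
  | .var x => x

def Value.toInt : Value S .int → ℤ
  | .int n => n

def Value.toBool : Value S .bool → Bool
  | .bool b => b

def Subst.id : Subst S := fun _ x => .var x

/-- First `θ`, then `δ`. -/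
def Subst.comp (θ δ : Subst S) : Subst S := fun s x => (θ s x).subst δ

/-- The substitution given by a map on variables. -/
def Subst.ofMap (ρ : S.Srt → ℕ → ℕ) : Subst S := fun s x => .var (ρ s x)

/-- Renamings of variables. -/
abbrev Renaming (S : Signature) : Type := S.Srt → Equiv.Perm ℕ

def Renaming.toSubst (ρ : Renaming S) : Subst S := Subst.ofMap (fun s x => ρ s x)

/-- `θ` is the identity outside the set `V` of variables. -/
def Subst.ActsOnlyOn (θ : Subst S) (V : Set (Var S)) : Prop :=
  ∀ s x, (⟨s, x⟩ : Var S) ∉ V → θ s x = .var x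

/-- `θ` is a most general one among the substitutions satisfying `U`
(where `U` is the set of unifiers of some terms or atoms). -/
def IsMGU (U : Subst S → Prop) (θ : Subst S) : Prop :=
  U θ ∧ ∀ σ, U σ → ∃ δ, σ = θ.comp δ

def bvars (V : Set (Var S)) : Set (Var S) := {v ∈ V | v.ty.IsBasic}

def adtVars (V : Set (Var S)) : Set (Var S) := {v ∈ V | ¬ v.ty.IsBasic}

/-! ### Constraints: quantifier-free formulas of linear integer arithmetic and booleans -/

inductive IntExpr : Type
  | var (x : ℕ)
  | const (n : ℤ)
  | add (e f : IntExpr)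
  | smul (k : ℤ) (e : IntExpr)

inductive Constraint : Type
  | tru
  | boolVar (x : ℕ)
  | le (e f : IntExpr)
  | eq (e f : IntExpr)
  | not (c : Constraint)
  | and (c d : Constraint)
  | or (c d : Constraint)

def IntExpr.eval (i : ℕ → ℤ) : IntExpr → ℤ
  | .var x => i x
  | .const n => n
  | .add e f => e.eval i + f.eval i
  | .smul k e => k * e.eval i

/-- Truth of a constraint in the standard interpretation, under an assignment of the integer and
boolean variables. -/
def Constraint.Holds (i : ℕ → ℤ) (b : ℕ → Bool) : Constraint → Prop
  | .tru => True
  | .boolVar x => b x = true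
  | .le e f => e.eval i ≤ f.eval i
  | .eq e f => e.eval i = f.eval i
  | .not c => ¬ c.Holds i b
  | .and c d => c.Holds i b ∧ d.Holds i b
  | .or c d => c.Holds i b ∨ d.Holds i b

def Constraint.HoldsAt (c : Constraint) (σ : Valuation S) : Prop :=
  c.Holds (fun x => (σ .int x).toInt) (fun x => (σ .bool x).toBool)

def Constraint.Sat (c : Constraint) : Prop := ∃ i b, c.Holds i b

/-- The universal closure of `c → d` is true in the standard interpretation. -/
def Entails (c d : Constraint) : Prop := ∀ i b, c.Holds i b → d.Holds i b

def IntExpr.vars (S : Signature) : IntExpr → Set (Var S)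
  | .var x => {⟨.int, x⟩}
  | .const _ => ∅
  | .add e f => e.vars S ∪ f.vars S
  | .smul _ e => e.vars S

def Constraint.vars (S : Signature) : Constraint → Set (Var S)
  | .tru => ∅
  | .boolVar x => {⟨.bool, x⟩}
  | .le e f => e.vars S ∪ f.vars S
  | .eq e f => e.vars S ∪ f.vars S
  | .not c => c.vars S
  | .and c d => c.vars S ∪ d.vars S
  | .or c d => c.vars S ∪ d.vars S

def IntExpr.subst (θ : Subst S) : IntExpr → IntExpr
  | .var x => .var (θ .int x).intIdx
  | .const n => .const n
  | .add e f => .add (e.subst θ) (f.subst θ)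
  | .smul k e => .smul k (e.subst θ)

def Constraint.subst (θ : Subst S) : Constraint → Constraint
  | .tru => .tru
  | .boolVar x => .boolVar (θ .bool x).boolIdx
  | .le e f => .le (e.subst θ) (f.subst θ)
  | .eq e f => .eq (e.subst θ) (f.subst θ)
  | .not c => .not (c.subst θ)
  | .and c d => .and (c.subst θ) (d.subst θ)
  | .or c d => .or (c.subst θ) (d.subst θ)

/-- The constraint `x = y` for two variables of the same basic type. -/
def Constraint.varEq : S.Srt → ℕ → ℕ → Constraint
  | .int, x, y => .eq (.var x) (.var y)
  | .bool, x, y =>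
      .or (.and (.boolVar x) (.boolVar y)) (.and (.not (.boolVar x)) (.not (.boolVar y)))
  | .adt _, _, _ => .tru

/-- `c` in conjunction with the equations `v = ρ v`, for the basic variables `v` in a list. -/
def Constraint.withEqs (c : Constraint) (ρ : S.Srt → ℕ → ℕ) (l : List (Var S)) : Constraint :=
  l.foldr (fun v d => .and (Constraint.varEq v.ty v.idx (ρ v.ty v.idx)) d) c

/-! ### Atoms, conjunctions, clauses -/

structure Atom (S : Signature) where
  pred : S.Pred
  args : ∀ i : Fin (S.predArgs pred).length, Term S ((S.predArgs pred).get i)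

/-- Conjunctions of atoms; the order of the atoms is irrelevant. -/
abbrev Conj (S : Signature) : Type := Multiset (Atom S)

/-- A constrained Horn clause `head ← constr, body`. The head `none` stands for `false`. -/
structure Clause (S : Signature) where
  head : Option (Atom S)
  constr : Constraint
  body : Conj S

def Atom.vars (A : Atom S) : Set (Var S) := ⋃ i, (A.args i).vars

def Atom.subst (θ : Subst S) (A : Atom S) : Atom S := ⟨A.pred, fun i => (A.args i).subst θ⟩

def Conj.vars (G : Conj S) : Set (Var S) := {v | ∃ A ∈ G, v ∈ A.vars}

def Conj.subst (θ : Subst S) (G : Conj S) : Conj S := Multiset.map (Atom.subst θ) G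

def headVars (H : Option (Atom S)) : Set (Var S) := {v | ∃ A ∈ H, v ∈ A.vars}

def Clause.vars (C : Clause S) : Set (Var S) :=
  headVars C.head ∪ C.constr.vars S ∪ Conj.vars C.body

def Clause.subst (θ : Subst S) (C : Clause S) : Clause S :=
  ⟨C.head.map (Atom.subst θ), C.constr.subst θ, Conj.subst θ C.body⟩

/-- `C` is a variant of `D`. -/
def IsVariant (C D : Clause S) : Prop := ∃ ρ : Renaming S, C = D.subst ρ.toSubst

/-- The predicate symbols occurring in a set of clauses. -/
def predsOf (P : Set (Clause S)) : Set S.Pred :=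
  {p | ∃ C ∈ P, (∃ A ∈ C.head, A.pred = p) ∨ ∃ A ∈ C.body, A.pred = p}

/-- The definite clauses of a set of clauses. -/
def definite (P : Set (Clause S)) : Set (Clause S) := {C ∈ P | C.head ≠ none}

/-- The goals of a set of clauses. -/
def goals (P : Set (Clause S)) : Set (Clause S) := {C ∈ P | C.head = none}

def Atom.HasBasicTypes (A : Atom S) : Prop := ∀ i, ((S.predArgs A.pred).get i).IsBasic

def Clause.HasBasicTypes (C : Clause S) : Prop :=
  (∀ A ∈ C.head, A.HasBasicTypes) ∧ ∀ A ∈ C.body, A.HasBasicTypes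

/-- No variable of basic type occurs more than once in the atom. -/
def Atom.Linear (A : Atom S) : Prop :=
  ∀ v : Var S, v.ty.IsBasic → ∑ i, (A.args i).occ v ≤ 1

/-- The arguments of `A` are the elements of `U`, without repetitions: `A` is `p(U)`. -/
def Atom.IsTuple (A : Atom S) (U : Set (Var S)) : Prop :=
  ∃ x : Fin (S.predArgs A.pred).length → ℕ,
    (∀ i, A.args i = .var (x i)) ∧
    Function.Injective (fun i => (⟨(S.predArgs A.pred).get i, x i⟩ : Var S)) ∧
    Set.range (fun i => (⟨(S.predArgs A.pred).get i, x i⟩ : Var S)) = U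

/-! ### Interpretations, satisfiability, least models -/

/-- Interpretations of the predicate symbols over the values. -/
abbrev Interp (S : Signature) : Type :=
  ∀ p : S.Pred, (∀ i : Fin (S.predArgs p).length, Value S ((S.predArgs p).get i)) → Prop

def Atom.Holds (I : Interp S) (σ : Valuation S) (A : Atom S) : Prop :=
  I A.pred (fun i => (A.args i).eval σ)

def Conj.Holds (I : Interp S) (σ : Valuation S) (G : Conj S) : Prop := ∀ A ∈ G, A.Holds I σ

def headHolds (I : Interp S) (σ : Valuation S) : Option (Atom S) → Prop
  | none => False
  | some A => A.Holds I σ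

def Clause.IsTrue (I : Interp S) (C : Clause S) : Prop :=
  ∀ σ, C.constr.HoldsAt σ → Conj.Holds I σ C.body → headHolds I σ C.head

def IsModel (I : Interp S) (P : Set (Clause S)) : Prop := ∀ C ∈ P, C.IsTrue I

def Satisfiable (P : Set (Clause S)) : Prop := ∃ I, IsModel I P

/-- The set of the ground atoms that are true in all models of `P`. -/
def leastModel (P : Set (Clause S)) : Interp S := fun p a => ∀ I, IsModel I P → I p a

/-! ### Functionality and totality -/

def AgreeOn (V : Set (Var S)) (σ τ : Valuation S) : Prop :=
  ∀ v ∈ V, σ v.ty v.idx = τ v.ty v.idx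

/-- `X` and `Y` are disjoint and `vars F = X ∪ Y`, as in the notation `F(X,Y)`. -/
def SplitsVars (F : Conj S) (X Y : Set (Var S)) : Prop := Disjoint X Y ∧ F.vars = X ∪ Y

/-- `∀ X Y Z. F(X,Y) ∧ F(X,Z) → Y = Z` is true in `I`. -/
def Functional (I : Interp S) (F : Conj S) (X Y : Set (Var S)) : Prop :=
  ∀ σ τ, AgreeOn X σ τ → F.Holds I σ → F.Holds I τ → AgreeOn Y σ τ

/-- `∀ X ∃ Y. F(X,Y)` is true in `I`. -/
def Total (I : Interp S) (F : Conj S) (Y : Set (Var S)) : Prop :=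
  ∀ σ, ∃ τ, AgreeOn Yᶜ σ τ ∧ F.Holds I τ

/-- `F` is a total, functional conjunction from `X` to `Y`, written `F(X;Y)`. -/
def TotalFunctional (I : Interp S) (F : Conj S) (X Y : Set (Var S)) : Prop :=
  SplitsVars F X Y ∧ Functional I F X Y ∧ Total I F Y

/-! ### Parameters of the algorithm -/

/-- The level mapping, the designation of the input arguments of the predicates, the
generalization and projection operators on constraints, and the ordering on tuples of terms.
The level mapping is given for the new predicates as well; a new predicate can only be introduced
with the level that its definition prescribes. -/
structure Params (S : Signature) where
  level : S.Pred → ℕ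
  isInput : (p : S.Pred) → Fin (S.predArgs p).length → Bool
  gen : Constraint → Constraint → Constraint
  gen_left : ∀ c d, Entails c (gen c d)
  gen_right : ∀ c d, Entails d (gen c d)
  proj : Constraint → Set (Var S) → Constraint
  proj_vars : ∀ c V, (proj c V).vars S ⊆ V
  proj_entails : ∀ c V, Entails c (proj c V)
  prec : List ((s : S.Srt) × Term S s) → List ((s : S.Srt) × Term S s) → Prop
  prec_wf : WellFounded prec
  prec_trans : ∀ t u v, prec t u → prec u v → prec t v
  prec_subst : ∀ (θ : Subst S) t u, prec t u →
    prec (t.map fun r => ⟨r.1, r.2.subst θ⟩) (u.map fun r => ⟨r.1, r.2.subst θ⟩)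

/-- The input variables of an atom. -/
def Params.inVars (P : Params S) (A : Atom S) : Set (Var S) :=
  {v | ∃ i, P.isInput A.pred i = true ∧ v ∈ (A.args i).vars}

/-- The output variables of an atom. -/
def Params.outVars (P : Params S) (A : Atom S) : Set (Var S) := A.vars \ P.inVars A

/-- The tuple of the input arguments of an atom. -/
def Params.inTuple (P : Params S) (A : Atom S) : List ((s : S.Srt) × Term S s) :=
  ((List.finRange _).filter (fun i => P.isInput A.pred i)).map (fun i => ⟨_, A.args i⟩)

/-- The variables of a conjunction that are input variables of some atom and output variables of
no atom. -/
def Params.sourceVars (P : Params S) (G : Conj S) : Set (Var S) :=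
  {v | (∃ A ∈ G, v ∈ P.inVars A) ∧ ∀ A ∈ G, v ∉ P.outVars A}

def Params.IsSourceAtom (P : Params S) (G : Conj S) (A : Atom S) : Prop :=
  P.inVars A ⊆ P.sourceVars G

/-- `ℓ(H) > ℓ(A)`; the level of `false` is above all levels. -/
def Params.HeadAbove (P : Params S) (H : Option (Atom S)) (A : Atom S) : Prop :=
  ∀ K ∈ H, P.level A.pred < P.level K.pred

/-! ### Sharing blocks and atomwise subsumption -/

/-- Two atoms of `G` share a variable of ADT type. -/
def Shares (G : Conj S) (A B : Atom S) : Prop :=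
  A ∈ G ∧ B ∈ G ∧ (adtVars A.vars ∩ adtVars B.vars).Nonempty

open Classical in
/-- `B` is one of the sharing blocks of `G`. -/
def IsSharingBlock (G B : Conj S) : Prop :=
  ∃ A ∈ G, B = Multiset.filter (fun A' => Relation.ReflTransGen (Shares G) A A') G

/-- `G` is its only sharing block. -/
def Connected (G : Conj S) : Prop :=
  G ≠ 0 ∧ ∀ A ∈ G, ∀ B ∈ G, Relation.ReflTransGen (Shares G) A B

def AtomwiseSubsumes (G₁ G₂ : Conj S) : Prop :=
  ∃ G ≤ G₂, Multiset.Rel (fun A B : Atom S => ∃ θ : Subst S, B = A.subst θ) G₁ G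

/-! ### Applications of folding and of differential replacement; Conditions (E) and (F) -/

/-- Record of an application of folding or of differential replacement. -/
inductive RuleApp (S : Signature) : Type
  /-- Clause `H ← c, Q, G` is folded using `K ← d, B`, with `Q = B θ`. -/
  | fold (H : Option (Atom S)) (c : Constraint) (G : Conj S)
      (K : Atom S) (d : Constraint) (B : Conj S) (θ : Subst S)
  /-- In clause `H ← c, G, F(X;Y)` the conjunction `F(X;Y)` is replaced using the definition
  `K ← d, F(X;Y), R(V;W)`; `defs` are the definitions introduced so far. -/
  | replace (H : Option (Atom S)) (c : Constraint) (G : Conj S)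
      (K : Atom S) (d : Constraint) (X Y V W : Set (Var S)) (defs : Set (Clause S))

/-- Condition (E) on the folding of `H ← c, Bθ, G` using `K ← d, B`. -/
def ConditionE (H : Option (Atom S)) (c : Constraint) (G : Conj S)
    (K : Atom S) (d : Constraint) (B : Conj S) (θ : Subst S) : Prop :=
  ∀ v ∈ (d.vars S ∪ B.vars) \ K.vars,
    ∃ z : ℕ, θ v.ty v.idx = .var z ∧
      (⟨v.ty, z⟩ : Var S) ∉ headVars H ∪ c.vars S ∪ G.vars ∧
      ∀ y ∈ d.vars S ∪ B.vars, y ≠ v → (⟨v.ty, z⟩ : Var S) ∉ (θ y.ty y.idx).vars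

/-- Condition (F) on the replacement in `H ← c, G, F(X;Y)` using `K ← d, F(X;Y), R(V;W)`,
where `Ds` are the definite clauses of the input and `defs` the definitions introduced so far. -/
def ConditionF (Ds : Set (Clause S)) (H : Option (Atom S)) (c : Constraint) (G : Conj S)
    (K : Atom S) (d : Constraint) (X Y V W : Set (Var S)) (defs : Set (Clause S)) : Prop :=
  Functional (leastModel (Ds ∪ defs)) {K} (bvars (X ∪ V) ∪ bvars W) (bvars Y) ∧
  Y ∩ (V ∪ d.vars S) = ∅ ∧
  adtVars Y ∩ adtVars (headVars H ∪ c.vars S ∪ G.vars) = ∅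

def RuleApp.IsFold : RuleApp S → Prop
  | .fold .. => True
  | .replace .. => False

/-- The recorded folding fulfills Condition (E). -/
def RuleApp.FulfillsE : RuleApp S → Prop
  | .fold H c G K d B θ => ConditionE H c G K d B θ
  | .replace .. => False

/-- The recorded replacement fulfills Condition (F). -/
def RuleApp.FulfillsF (Ds : Set (Clause S)) : RuleApp S → Prop
  | .fold .. => False
  | .replace H c G K d X Y V W defs => ConditionF Ds H c G K d X Y V W defs

/-- Finite sequences of steps of a relation that records rule applications. -/
inductive Steps {St α : Type} (r : St → List α → St → Prop) : St → List α → St → Prop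
  | refl (s : St) : Steps r s [] s
  | step {s t u : St} {l m : List α} : r s l t → Steps r t m u → Steps r s (l ++ m) u

/-! ### Procedure Diff-Define-Fold -/

/-- The clause `K ← c, B` with head `K = p(U)` may be introduced as a new definition: the predicate
`p` is new, the predicates of `B` occur in the input clauses, the variables `U` occur in the body,
and the level of `p` is the maximal level of the atoms in `B`. -/
def IsNewDef (P : Params S) (Cls defs : Set (Clause S)) (U : Set (Var S))
    (K : Atom S) (c : Constraint) (B : Conj S) : Prop :=
  K.IsTuple U ∧ K.pred ∉ predsOf (Cls ∪ defs) ∧ (∀ A ∈ B, A.pred ∈ predsOf Cls) ∧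
  U ⊆ c.vars S ∪ B.vars ∧ P.level K.pred = (B.map (fun A => P.level A.pred)).sup

/-- `K ← d, B'` is a variant of a clause in `defs`, with `K = newp(U)` and `U = bvars({d,B'})`. -/
def IsDefVariant (defs : Set (Clause S)) (K : Atom S) (d : Constraint) (B' : Conj S) : Prop :=
  (∃ D ∈ defs, IsVariant ⟨some K, d, B'⟩ D) ∧ K.IsTuple (bvars (d.vars S ∪ B'.vars))

/-- `B` is an instance `B'θ` of the atoms in the body of a variant `K ← d, B'` of a definition. -/
def InstanceOfDef (defs : Set (Clause S)) (B : Conj S)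
    (K : Atom S) (d : Constraint) (B' : Conj S) (θ : Subst S) : Prop :=
  IsDefVariant defs K d B' ∧ θ.ActsOnlyOn (adtVars B'.vars) ∧ B = B'.subst θ

/-- The case (Fold) applies, for a clause with constraint `c` and sharing block `B`. -/
def FoldCase (defs : Set (Clause S)) (c : Constraint) (B : Conj S) : Prop :=
  ∃ K d B' θ, InstanceOfDef defs B K d B' θ ∧ Entails c d

/-- The case (Generalize) applies, when (Fold) does not. -/
def GeneralizeCase (defs : Set (Clause S)) (c : Constraint) (B : Conj S) : Prop :=
  ∃ K d B' θ, InstanceOfDef defs B K d B' θ ∧ ¬ Entails c d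

/-- The sharing block `B` of the clause `H ← c, B, G'` matches partially the body of a variant
`K ← d, B'` of a definition: `B = (M, F(X;Y))` and `B'θ = (M, R(V;W))`. -/
def PartialMatch (P : Params S) (Ds defs : Set (Clause S)) (H : Option (Atom S)) (c : Constraint)
    (B G' : Conj S) (K : Atom S) (d : Constraint) (B' : Conj S)
    (M F : Conj S) (X Y : Set (Var S)) (θ : Subst S) (R : Conj S) (V W : Set (Var S)) : Prop :=
  IsDefVariant defs K d B' ∧ AtomwiseSubsumes B' B ∧
  Connected M ∧ B = M + F ∧ F ≠ 0 ∧
  θ.ActsOnlyOn (adtVars B'.vars) ∧ B'.subst θ = M + R ∧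
  TotalFunctional (leastModel (Ds ∪ defs)) F X Y ∧
  TotalFunctional (leastModel (Ds ∪ defs)) R V W ∧
  W ∩ (Clause.vars ⟨H, c, B + G'⟩) = ∅ ∧
  ∀ A ∈ F, P.HeadAbove H A

/-- The case (Diff-Introduce) applies, when (Fold) and (Generalize) do not. -/
def DiffIntroduceCase (P : Params S) (Ds defs : Set (Clause S)) (H : Option (Atom S))
    (c : Constraint) (B G' : Conj S) : Prop :=
  ∃ K d B' M F X Y θ R V W, PartialMatch P Ds defs H c B G' K d B' M F X Y θ R V W

/-- A partial match whose connected subconjunction `M` is maximal. -/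
def MaximalMatch (P : Params S) (Ds defs : Set (Clause S)) (H : Option (Atom S)) (c : Constraint)
    (B G' : Conj S) (K : Atom S) (d : Constraint) (B' : Conj S)
    (M F : Conj S) (X Y : Set (Var S)) (θ : Subst S) (R : Conj S) (V W : Set (Var S)) : Prop :=
  PartialMatch P Ds defs H c B G' K d B' M F X Y θ R V W ∧
  ∀ M₁ F₁ X₁ Y₁ θ₁ R₁ V₁ W₁,
    PartialMatch P Ds defs H c B G' K d B' M₁ F₁ X₁ Y₁ θ₁ R₁ V₁ W₁ → M ≤ M₁ → M₁ = M

structure FoldState (S : Signature) where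
  inCls : Set (Clause S)
  newDefs : Set (Clause S)
  fldCls : Set (Clause S)

/-- `C = (H ← c, B, G')` is a clause to be processed, it has ADTs, and `B` is a sharing block of
its body that contains an atom that has ADTs. -/
def Selected (s : FoldState S) (H : Option (Atom S)) (c : Constraint) (B G' : Conj S) : Prop :=
  (⟨H, c, B + G'⟩ : Clause S) ∈ s.inCls ∧ ¬ Clause.HasBasicTypes ⟨H, c, B + G'⟩ ∧
  IsSharingBlock (B + G') B ∧ ∃ A ∈ B, ¬ A.HasBasicTypes

/-- The state after replacing `C` by `E` and introducing the definitions in `N`. -/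
def FoldState.update (s : FoldState S) (C E : Clause S) (N : Set (Clause S)) : FoldState S :=
  ⟨(s.inCls \ {C}) ∪ {E}, s.newDefs ∪ N, s.fldCls⟩

/-- One iteration of the loop of the procedure, with the foldings and the differential
replacements that it performs. -/
inductive FoldStep (P : Params S) (Cls Defs : Set (Clause S)) :
    FoldState S → List (RuleApp S) → FoldState S → Prop
  | basic (s : FoldState S) (C : Clause S) :
      C ∈ s.inCls → C.HasBasicTypes →
      FoldStep P Cls Defs s [] ⟨s.inCls \ {C}, s.newDefs, s.fldCls ∪ {C}⟩
  | fold (s : FoldState S) (H : Option (Atom S)) (c : Constraint) (B G' : Conj S)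
      (K : Atom S) (d : Constraint) (B' : Conj S) (θ : Subst S) :
      Selected s H c B G' →
      InstanceOfDef (Defs ∪ s.newDefs) B K d B' θ → Entails c d →
      FoldStep P Cls Defs s [.fold H c G' K d B' θ]
        (s.update ⟨H, c, B + G'⟩ ⟨H, c, K ::ₘ G'⟩ ∅)
  | generalize (s : FoldState S) (H : Option (Atom S)) (c : Constraint) (B G' : Conj S)
      (K : Atom S) (d : Constraint) (B' : Conj S) (θ : Subst S) (K₁ : Atom S) :
      Selected s H c B G' →
      ¬ FoldCase (Defs ∪ s.newDefs) c B →
      InstanceOfDef (Defs ∪ s.newDefs) B K d B' θ → ¬ Entails c d →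
      IsNewDef P Cls (Defs ∪ s.newDefs) (bvars (d.vars S ∪ B'.vars)) K₁ (P.gen d c) B' →
      FoldStep P Cls Defs s [.fold H c G' K₁ (P.gen d c) B' θ]
        (s.update ⟨H, c, B + G'⟩ ⟨H, c, K₁ ::ₘ G'⟩ {⟨some K₁, P.gen d c, B'⟩})
  | diffFold (s : FoldState S) (H : Option (Atom S)) (c : Constraint) (B G' : Conj S)
      (K : Atom S) (d : Constraint) (B' M F : Conj S) (X Y : Set (Var S)) (θ : Subst S)
      (R : Conj S) (V W : Set (Var S)) (K₀ : Atom S) :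
      Selected s H c B G' →
      ¬ FoldCase (Defs ∪ s.newDefs) c B →
      ¬ GeneralizeCase (Defs ∪ s.newDefs) c B →
      MaximalMatch P (definite Cls) (Defs ∪ s.newDefs) H c B G' K d B' M F X Y θ R V W →
      IsNewDef P Cls (Defs ∪ s.newDefs) (bvars (F.vars ∪ R.vars)) K₀ (P.proj c X) (F + R) →
      Entails c d →
      FoldStep P Cls Defs s
        [.replace H c (M + G') K₀ (P.proj c X) X Y V W
            (Defs ∪ s.newDefs ∪ {⟨some K₀, P.proj c X, F + R⟩}),
         .fold H c (K₀ ::ₘ G') K d B' θ]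
        (s.update ⟨H, c, B + G'⟩ ⟨H, c, K ::ₘ K₀ ::ₘ G'⟩ {⟨some K₀, P.proj c X, F + R⟩})
  | diffGeneralize (s : FoldState S) (H : Option (Atom S)) (c : Constraint) (B G' : Conj S)
      (K : Atom S) (d : Constraint) (B' M F : Conj S) (X Y : Set (Var S)) (θ : Subst S)
      (R : Conj S) (V W : Set (Var S)) (K₀ K₁ : Atom S) :
      Selected s H c B G' →
      ¬ FoldCase (Defs ∪ s.newDefs) c B →
      ¬ GeneralizeCase (Defs ∪ s.newDefs) c B →
      MaximalMatch P (definite Cls) (Defs ∪ s.newDefs) H c B G' K d B' M F X Y θ R V W →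
      IsNewDef P Cls (Defs ∪ s.newDefs) (bvars (F.vars ∪ R.vars)) K₀ (P.proj c X) (F + R) →
      ¬ Entails c d →
      IsNewDef P Cls (Defs ∪ s.newDefs ∪ {⟨some K₀, P.proj c X, F + R⟩})
        (bvars (d.vars S ∪ B'.vars)) K₁ (P.gen d c) B' →
      FoldStep P Cls Defs s
        [.replace H c (M + G') K₀ (P.proj c X) X Y V W
            (Defs ∪ s.newDefs ∪ {⟨some K₀, P.proj c X, F + R⟩}),
         .fold H c (K₀ ::ₘ G') K₁ (P.gen d c) B' θ]
        (s.update ⟨H, c, B + G'⟩ ⟨H, c, K₁ ::ₘ K₀ ::ₘ G'⟩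
          {⟨some K₀, P.proj c X, F + R⟩, ⟨some K₁, P.gen d c, B'⟩})
  | project (s : FoldState S) (H : Option (Atom S)) (c : Constraint) (B G' : Conj S)
      (K : Atom S) :
      Selected s H c B G' →
      ¬ FoldCase (Defs ∪ s.newDefs) c B →
      ¬ GeneralizeCase (Defs ∪ s.newDefs) c B →
      ¬ DiffIntroduceCase P (definite Cls) (Defs ∪ s.newDefs) H c B G' →
      IsNewDef P Cls (Defs ∪ s.newDefs) (bvars B.vars) K
        (P.proj c (bvars (P.sourceVars B))) B →
      FoldStep P Cls Defs s
        [.fold H c G' K (P.proj c (bvars (P.sourceVars B))) B Subst.id]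
        (s.update ⟨H, c, B + G'⟩ ⟨H, c, K ::ₘ G'⟩
          {⟨some K, P.proj c (bvars (P.sourceVars B)), B⟩})

/-- The procedure, which ends when no clause is left to be processed. -/
def DiffDefineFold (P : Params S) (Cls Defs InCls : Set (Clause S)) (apps : List (RuleApp S))
    (NewDefs FldCls : Set (Clause S)) : Prop :=
  Steps (FoldStep P Cls Defs) ⟨InCls, ∅, ∅⟩ apps ⟨∅, NewDefs, FldCls⟩

/-! ### Procedure Unfold -/

/-- Clauses in which some of the body atoms are marked as unfoldable. -/
structure MClause (S : Signature) where
  head : Option (Atom S)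
  constr : Constraint
  marked : Conj S
  unmarked : Conj S

def MClause.body (C : MClause S) : Conj S := C.marked + C.unmarked

def MClause.toClause (C : MClause S) : Clause S := ⟨C.head, C.constr, C.body⟩

def MClause.markAll (C : MClause S) : MClause S := ⟨C.head, C.constr, C.body, 0⟩

/-- The marking of a definition at the beginning of the first phase. -/
def MClause.InitialMarking (P : Params S) (C : MClause S) : Prop :=
  ∃ A T, C.marked = A ::ₘ T ∧ (∀ H ∈ C.head, P.level H.pred = P.level A.pred) ∧
    (∀ A' ∈ T, P.IsSourceAtom C.body A') ∧ P.sourceVars C.body ⊆ Conj.vars C.marked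

/-- `R` is obtained by resolving `C`, with body consisting of `A`, of the other marked atoms `m`
and of the other unmarked atoms `u`, with the clause `D` (renamed apart) on the atom `A`; the
constraint of `R` is satisfiable. Atoms derived from `A` are not marked. -/
def Resolvent (D : Clause S) (C : MClause S) (A : Atom S) (m u : Conj S) (R : MClause S) : Prop :=
  ∃ (K : Atom S) (d : Constraint) (B : Conj S) (θ : Subst S),
    IsVariant ⟨some K, d, B⟩ D ∧
    Clause.vars ⟨some K, d, B⟩ ∩ C.toClause.vars = ∅ ∧
    IsMGU (fun η => A.subst η = K.subst η) θ ∧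
    ((C.constr.and d).subst θ).Sat ∧
    R = ⟨C.head.map (Atom.subst θ), (C.constr.and d).subst θ, m.subst θ, (u + B).subst θ⟩

/-- `R'` is obtained from `R` by replacing some occurrences of variables of basic type by new
variables that are constrained to be equal to them, in such a way that no variable of basic type
occurs more than once in an atom. -/
def Linearizes (R R' : MClause S) : Prop :=
  (∀ A ∈ R'.head, A.Linear) ∧ (∀ A ∈ R'.body, A.Linear) ∧
  ∃ (N : List (Var S)) (ρ : S.Srt → ℕ → ℕ),
    N.Nodup ∧ (∀ v ∈ N, v.ty.IsBasic ∧ v ∉ R.toClause.vars) ∧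
    (∀ v : Var S, v ∉ N → ρ v.ty v.idx = v.idx) ∧
    (∀ v ∈ N, (⟨v.ty, ρ v.ty v.idx⟩ : Var S) ∈ R.toClause.vars) ∧
    R'.head.map (Atom.subst (Subst.ofMap ρ)) = R.head ∧
    R'.marked.subst (Subst.ofMap ρ) = R.marked ∧
    R'.unmarked.subst (Subst.ofMap ρ) = R.unmarked ∧
    R'.constr = R.constr.withEqs ρ N

/-- `U` is the set of clauses derived by unfolding `C` with respect to `A` using `Ds`: one resolvent
(possibly brought into linear form) for each clause of `Ds` that has one. -/
def IsUnf (Ds : Set (Clause S)) (C : MClause S) (A : Atom S) (m u : Conj S)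
    (U : Set (MClause S)) : Prop :=
  ∃ f : Clause S → MClause S,
    (∀ D ∈ Ds, (∃ R, Resolvent D C A m u R) →
      ∃ R, Resolvent D C A m u R ∧ (f D = R ∨ Linearizes R (f D))) ∧
    U = f '' {D ∈ Ds | ∃ R, Resolvent D C A m u R}

/-- `A` is an unfoldable atom of `C`, with other marked atoms `m` and other unmarked atoms `u`. -/
def MClause.PicksMarked (C : MClause S) (A : Atom S) (m u : Conj S) : Prop :=
  C.marked = A ::ₘ m ∧ C.unmarked = u

/-- `A` is an atom of `C` that is not unfoldable. -/
def MClause.PicksUnmarked (C : MClause S) (A : Atom S) (m u : Conj S) : Prop :=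
  C.marked = m ∧ C.unmarked = A ::ₘ u

/-- `A` in the body of `C` is a head-instance with respect to `Ds`: unification with the heads of the
clauses in `Ds` only renames the input variables of `A`. -/
def IsHeadInstance (P : Params S) (Ds : Set (Clause S)) (C : MClause S) (A : Atom S) : Prop :=
  ∀ (K : Atom S) (d : Constraint) (B : Conj S) (θ : Subst S),
    (∃ D ∈ Ds, IsVariant ⟨some K, d, B⟩ D) →
    Clause.vars ⟨some K, d, B⟩ ∩ C.toClause.vars = ∅ →
    IsMGU (fun η => A.subst η = K.subst η) θ →
    ((C.constr.and d).subst θ).Sat →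
    (∀ v ∈ P.inVars A, ∃ z, θ v.ty v.idx = .var z) ∧
    Set.InjOn (fun v : Var S => (⟨v.ty, θ v.ty v.idx⟩ : (s : S.Srt) × Term S s)) (P.inVars A)

def ImmediatelyDependsOn (Ds : Set (Clause S)) (p q : S.Pred) : Prop :=
  ∃ C ∈ Ds, (∃ H ∈ C.head, H.pred = p) ∧ ∃ A ∈ C.body, A.pred = q

def DependsOn (Ds : Set (Clause S)) : S.Pred → S.Pred → Prop :=
  Relation.TransGen (ImmediatelyDependsOn Ds)

def IsDescending (P : Params S) (Ds : Set (Clause S)) (p : S.Pred) : Prop :=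
  ∀ C ∈ Ds, ∀ H ∈ C.head, H.pred = p → ∀ A ∈ C.body, DependsOn Ds A.pred p →
    P.prec (P.inTuple A) (P.inTuple H)

/-- Clause `C` may be unfolded with respect to `A` in the second phase. -/
def Phase2Picks (P : Params S) (Ds : Set (Clause S)) (C : MClause S) (A : Atom S)
    (m u : Conj S) : Prop :=
  IsHeadInstance P Ds C A ∧
    (C.PicksMarked A m u ∨ (C.PicksUnmarked A m u ∧ IsDescending P Ds A.pred))

/-- An unfolding of a clause with respect to an atom allowed by `picks`. -/
def UnfoldStep (Ds : Set (Clause S)) (picks : MClause S → Atom S → Conj S → Conj S → Prop)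
    (s t : Set (MClause S)) : Prop :=
  ∃ C ∈ s, ∃ A m u U, picks C A m u ∧ IsUnf Ds C A m u U ∧ t = (s \ {C}) ∪ U

/-- Unfolding as long as there is an atom allowed by `picks`. -/
def UnfoldPhase (Ds : Set (Clause S)) (picks : MClause S → Atom S → Conj S → Conj S → Prop)
    (s t : Set (MClause S)) : Prop :=
  Relation.ReflTransGen (UnfoldStep Ds picks) s t ∧ ¬ ∃ C ∈ t, ∃ A m u, picks C A m u

def Unfold (P : Params S) (Ds NewDefs UnfCls : Set (Clause S)) : Prop :=
  ∃ (mark : Clause S → MClause S) (s₁ s₂ : Set (MClause S)),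
    (∀ C ∈ NewDefs, (mark C).toClause = C ∧ (mark C).InitialMarking P) ∧
    UnfoldPhase Ds MClause.PicksMarked (mark '' NewDefs) s₁ ∧
    UnfoldPhase Ds (Phase2Picks P Ds) (MClause.markAll '' s₁) s₂ ∧
    UnfCls = MClause.toClause '' s₂

/-! ### Procedure Replace -/

/-- Clause deletion: the constraint of the clause is unsatisfiable. -/
def DeleteStep (s t : Set (Clause S)) : Prop :=
  ∃ C ∈ s, ¬ C.constr.Sat ∧ t = s \ {C}

/-- Functionality rule, with respect to the clauses in `s ∪ Ds`: from `H ← c, F(X,Y), F(X,Z), G`,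
where `F(X,Y)` is functional from `X` to `Y` and `Z` is the tuple of the variables `ζ y`, for `y`
in `Y`, derive `H ← c, Y = Z, F(X,Y), G`. The equations between variables of basic type are added
to the constraint, and those between variables of ADT type are solved by a most general unifier. -/
def FunctionalityStep (Ds s t : Set (Clause S)) : Prop :=
  ∃ (H : Option (Atom S)) (c : Constraint) (F G : Conj S) (X Y : Set (Var S))
    (ζ : S.Srt → ℕ → ℕ) (l : List (Var S)) (θ : Subst S),
    (⟨H, c, F + F.subst (Subst.ofMap ζ) + G⟩ : Clause S) ∈ s ∧ F ≠ 0 ∧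
    SplitsVars F X Y ∧ Functional (leastModel (s ∪ Ds)) F X Y ∧
    (∀ v : Var S, v ∉ Y → ζ v.ty v.idx = v.idx) ∧
    Set.InjOn (fun v : Var S => (⟨v.ty, ζ v.ty v.idx⟩ : Var S)) Y ∧
    (∀ v ∈ Y, (⟨v.ty, ζ v.ty v.idx⟩ : Var S) ∉ X) ∧
    l.Nodup ∧ (∀ v, v ∈ l ↔ v ∈ bvars Y) ∧
    IsMGU (fun η => ∀ v ∈ adtVars Y, η v.ty v.idx = η v.ty (ζ v.ty v.idx)) θ ∧
    t = (s \ {⟨H, c, F + F.subst (Subst.ofMap ζ) + G⟩}) ∪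
      {Clause.subst θ ⟨H, c.withEqs ζ l, F + G⟩}

/-- Totality rule, with respect to the clauses in `s ∪ Ds`. -/
def TotalityStep (Ds s t : Set (Clause S)) : Prop :=
  ∃ (H : Option (Atom S)) (c : Constraint) (F G : Conj S) (X Y : Set (Var S)),
    (⟨H, c, F + G⟩ : Clause S) ∈ s ∧ F ≠ 0 ∧
    SplitsVars F X Y ∧ Total (leastModel (s ∪ Ds)) F Y ∧ Y ∩ Clause.vars ⟨H, c, G⟩ = ∅ ∧
    t = (s \ {⟨H, c, F + G⟩}) ∪ {⟨H, c, G⟩}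

/-- `if` the step `r` is possible `then` perform it. -/
def IfApplicable {St : Type} (r : St → St → Prop) (s t : St) : Prop :=
  r s t ∨ ((¬ ∃ t', r s t') ∧ t = s)

def ReplaceBody (Ds s t : Set (Clause S)) : Prop :=
  ∃ s₁ s₂, IfApplicable DeleteStep s s₁ ∧ IfApplicable (FunctionalityStep Ds) s₁ s₂ ∧
    IfApplicable (TotalityStep Ds) s₂ t

def Replace (Ds UnfCls RCls : Set (Clause S)) : Prop :=
  Relation.ReflTransGen (ReplaceBody Ds) UnfCls RCls ∧
  ¬ ∃ t, DeleteStep RCls t ∨ FunctionalityStep Ds RCls t ∨ TotalityStep Ds RCls t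

/-! ### The algorithm -/

structure AlgState (S : Signature) where
  inCls : Set (Clause S)
  defs : Set (Clause S)
  transfCls : Set (Clause S)

/-- One iteration of the main loop. -/
def Iteration (P : Params S) (Cls : Set (Clause S)) (s : AlgState S) (apps : List (RuleApp S))
    (t : AlgState S) : Prop :=
  s.inCls.Nonempty ∧ ∃ NewDefs FldCls UnfCls RCls,
    DiffDefineFold P Cls s.defs s.inCls apps NewDefs FldCls ∧
    Unfold P (definite Cls) NewDefs UnfCls ∧
    Replace (definite Cls) UnfCls RCls ∧
    t = ⟨RCls, s.defs ∪ NewDefs, s.transfCls ∪ FldCls⟩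

/-- The algorithm, run with parameters `P` on the input `Cls`, may terminate with output
`TransfCls`, where `apps` lists the foldings and the differential replacements of the run. -/
def AlgorithmR (P : Params S) (Cls : Set (Clause S)) (apps : List (RuleApp S))
    (TransfCls : Set (Clause S)) : Prop :=
  ∃ Defs, Steps (Iteration P Cls) ⟨goals Cls, ∅, ∅⟩ apps ⟨∅, Defs, TransfCls⟩

end CHC

end

noncomputable section

namespace CHC

variable {S : Signature}

/-! ### Evaluation under substitutions and on agreeing valuations -/

/-! One interpretation, fixed in advance, makes every clause arising in the run true. Let `Defs`
collect all definitions introduced by the end of the run. Each defines a fresh predicate in terms of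
predicates of `Cls` alone, so there is no recursion among them and `defModel Cls Defs` can be
written down outright: the predicates of `Cls` get the least model of the definite clauses, and a
new predicate holds exactly when the body of its definition does, local variables being
existentially quantified. The goals of `Cls` are true there because the least model lies below any
model of `Cls` (`isModel_defModel`). The gain over an arbitrary model is that the definitions may
also be read from head to body (`isCompleted_defModel`).

Each rule then preserves truth in this interpretation. Unfolding is resolution with true clauses
(`Resolvent.isTrue`). When a clause is folded, the new atom yields witnesses for the atoms it
replaced, and Condition (E) leaves the local variables free to take them (`isTrue_fold`). When
F(X;Y) is replaced differentially, totality provides values of Y that make F true, the difference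
predicate then holds for these values too, and its functionality, from Condition (F), forces the
basic ones to be the original ones; the ADT ones occur nowhere else (`isTrue_replace`).

Totality and functionality are assumed in least models of the clauses available at the time and
travel to the fixed model differently. Totality survives enlarging the interpretation
(`Total.mono`). Functionality survives shrinking it, and on the difference predicate the fixed model
is contained in the earlier least model (`Atom.Holds.of_defModel`). -/

/-- The valuation that evaluates every variable as its image under `θ`. -/
def Subst.pull (θ : Subst S) (σ : Valuation S) : Valuation S := fun s x => (θ s x).eval σ

/-- The substitution lemma. Through it, truth of an instance becomes truth of the original at the
pulled valuation, which is how all rules that instantiate clauses are treated. -/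
theorem Term.eval_subst (θ : Subst S) (σ : Valuation S) {s : S.Srt} (t : Term S s) :
    (t.subst θ).eval σ = t.eval (θ.pull σ) := by
  induction t with
  | var x => rfl
  | con k args ih => simp only [Term.subst, Term.eval, ih]

theorem Term.eval_congr {σ τ : Valuation S} {s : S.Srt} (t : Term S s)
    (h : AgreeOn t.vars σ τ) : t.eval σ = t.eval τ := by
  induction t with
  | var x => exact h ⟨_, x⟩ (by simp [Term.vars])
  | con k args ih =>
    simp only [Term.eval]
    congr 1
    funext i
    exact ih i fun v hv => h v (by simp only [Term.vars, Set.mem_iUnion]; exact ⟨i, hv⟩)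

theorem AgreeOn.mono {V W : Set (Var S)} {σ τ : Valuation S} (h : AgreeOn W σ τ) (hVW : V ⊆ W) :
    AgreeOn V σ τ := fun v hv => h v (hVW hv)

theorem Term.eval_int (σ : Valuation S) (t : Term S .int) : t.eval σ = σ .int t.intIdx := by
  cases t; rfl

theorem Term.eval_bool (σ : Valuation S) (t : Term S .bool) : t.eval σ = σ .bool t.boolIdx := by
  cases t; rfl

theorem IntExpr.eval_subst (θ : Subst S) (σ : Valuation S) (e : IntExpr) :
    (e.subst θ).eval (fun x => (σ .int x).toInt) =
      e.eval (fun x => (θ.pull σ .int x).toInt) := by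
  induction e with
  | var x => simp only [IntExpr.subst, IntExpr.eval, Subst.pull, Term.eval_int]
  | const n => rfl
  | add e f he hf => simp only [IntExpr.subst, IntExpr.eval, he, hf]
  | smul k e he => simp only [IntExpr.subst, IntExpr.eval, he]

theorem Constraint.holdsAt_subst (θ : Subst S) (σ : Valuation S) (c : Constraint) :
    (c.subst θ).HoldsAt σ ↔ c.HoldsAt (θ.pull σ) := by
  induction c with
  | tru => rfl
  | boolVar x =>
    simp only [Constraint.HoldsAt, Constraint.subst, Constraint.Holds, Subst.pull, Term.eval_bool]
  | le e f => simp only [Constraint.HoldsAt, Constraint.subst, Constraint.Holds, IntExpr.eval_subst]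
  | eq e f => simp only [Constraint.HoldsAt, Constraint.subst, Constraint.Holds, IntExpr.eval_subst]
  | not c hc => exact not_congr hc
  | and c d hc hd => exact and_congr hc hd
  | or c d hc hd => exact or_congr hc hd

theorem IntExpr.eval_congr {σ τ : Valuation S} (e : IntExpr) (h : AgreeOn (e.vars S) σ τ) :
    e.eval (fun x => (σ .int x).toInt) = e.eval (fun x => (τ .int x).toInt) := by
  induction e with
  | var x =>
    have := h ⟨.int, x⟩ (by simp [IntExpr.vars])
    simp only at this
    simp only [IntExpr.eval, this]
  | const n => rfl
  | add e f he hf =>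
    simp only [IntExpr.eval, he (h.mono Set.subset_union_left), hf (h.mono Set.subset_union_right)]
  | smul k e he => simp only [IntExpr.eval, he h]

theorem Constraint.holdsAt_congr {σ τ : Valuation S} (c : Constraint)
    (h : AgreeOn (c.vars S) σ τ) : c.HoldsAt σ ↔ c.HoldsAt τ := by
  induction c with
  | tru => rfl
  | boolVar x =>
    have := h ⟨.bool, x⟩ (by simp [Constraint.vars])
    simp only at this
    simp only [Constraint.HoldsAt, Constraint.Holds, this]
  | le e f =>
    simp only [Constraint.HoldsAt, Constraint.Holds,
      e.eval_congr (h.mono Set.subset_union_left), f.eval_congr (h.mono Set.subset_union_right)]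
  | eq e f =>
    simp only [Constraint.HoldsAt, Constraint.Holds,
      e.eval_congr (h.mono Set.subset_union_left), f.eval_congr (h.mono Set.subset_union_right)]
  | not c hc => exact not_congr (hc h)
  | and c d hc hd =>
    exact and_congr (hc (h.mono Set.subset_union_left)) (hd (h.mono Set.subset_union_right))
  | or c d hc hd =>
    exact or_congr (hc (h.mono Set.subset_union_left)) (hd (h.mono Set.subset_union_right))

theorem Atom.holds_subst (I : Interp S) (θ : Subst S) (σ : Valuation S) (A : Atom S) :
    (A.subst θ).Holds I σ ↔ A.Holds I (θ.pull σ) := by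
  simp only [Atom.Holds, Atom.subst, Term.eval_subst]

theorem Atom.holds_congr (I : Interp S) {σ τ : Valuation S} (A : Atom S)
    (h : AgreeOn A.vars σ τ) : A.Holds I σ ↔ A.Holds I τ := by
  have : (fun i => (A.args i).eval σ) = fun i => (A.args i).eval τ := by
    funext i
    exact (A.args i).eval_congr (h.mono (Set.subset_iUnion (fun i => (A.args i).vars) i))
  simp only [Atom.Holds, this]

theorem Conj.holds_subst (I : Interp S) (θ : Subst S) (σ : Valuation S) (G : Conj S) :
    Conj.Holds I σ (Conj.subst θ G) ↔ Conj.Holds I (θ.pull σ) G := by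
  simp [Conj.Holds, Conj.subst, Atom.holds_subst]

theorem Conj.holds_congr (I : Interp S) {σ τ : Valuation S} (G : Conj S)
    (h : AgreeOn (Conj.vars G) σ τ) : Conj.Holds I σ G ↔ Conj.Holds I τ G :=
  forall₂_congr fun A hA => A.holds_congr I (h.mono fun _ hv => ⟨A, hA, hv⟩)

theorem Conj.holds_add (I : Interp S) (σ : Valuation S) (F G : Conj S) :
    Conj.Holds I σ (F + G) ↔ Conj.Holds I σ F ∧ Conj.Holds I σ G := by
  simp only [Conj.Holds, Multiset.mem_add, or_imp, forall_and]

theorem Conj.holds_cons (I : Interp S) (σ : Valuation S) (A : Atom S) (G : Conj S) :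
    Conj.Holds I σ (A ::ₘ G) ↔ A.Holds I σ ∧ Conj.Holds I σ G := by
  simp [Conj.Holds]

theorem Conj.vars_add (F G : Conj S) : Conj.vars (F + G) = Conj.vars F ∪ Conj.vars G := by
  ext v
  simp only [Conj.vars, Set.mem_ofPred_eq, Multiset.mem_add, Set.mem_union]
  constructor
  · rintro ⟨A, hA | hA, hv⟩
    exacts [.inl ⟨A, hA, hv⟩, .inr ⟨A, hA, hv⟩]
  · rintro (⟨A, hA, hv⟩ | ⟨A, hA, hv⟩)
    exacts [⟨A, .inl hA, hv⟩, ⟨A, .inr hA, hv⟩]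

theorem headHolds_subst (I : Interp S) (θ : Subst S) (σ : Valuation S) (H : Option (Atom S)) :
    headHolds I σ (H.map (Atom.subst θ)) ↔ headHolds I (θ.pull σ) H := by
  cases H with
  | none => rfl
  | some A => exact A.holds_subst I θ σ

theorem headHolds_congr (I : Interp S) {σ τ : Valuation S} (H : Option (Atom S))
    (h : AgreeOn (headVars H) σ τ) : headHolds I σ H ↔ headHolds I τ H := by
  cases H with
  | none => rfl
  | some A => exact A.holds_congr I (h.mono fun _ hv => ⟨A, rfl, hv⟩)

theorem Clause.isTrue_subst {I : Interp S} {C : Clause S} (h : C.IsTrue I) (θ : Subst S) :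
    (C.subst θ).IsTrue I := fun σ hc hB =>
  (headHolds_subst I θ σ C.head).2
    (h _ ((C.constr.holdsAt_subst θ σ).1 hc) ((Conj.holds_subst I θ σ C.body).1 hB))

theorem Constraint.holdsAt_and (c d : Constraint) (σ : Valuation S) :
    (c.and d).HoldsAt σ ↔ c.HoldsAt σ ∧ d.HoldsAt σ := Iff.rfl

theorem Entails.holdsAt {c d : Constraint} (h : Entails c d) {σ : Valuation S}
    (hc : c.HoldsAt σ) : d.HoldsAt σ := h _ _ hc

theorem Constraint.eq_of_varEq {s : S.Srt} (hs : s.IsBasic) {x y : ℕ} {σ : Valuation S}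
    (h : (Constraint.varEq s x y).HoldsAt σ) : σ s x = σ s y := by
  cases s with
  | int =>
    simp only [Constraint.varEq, Constraint.HoldsAt, Constraint.Holds, IntExpr.eval] at h
    generalize σ .int x = a at *
    generalize σ .int y = b at *
    cases a; cases b
    exact congrArg _ h
  | bool =>
    simp only [Constraint.varEq, Constraint.HoldsAt, Constraint.Holds] at h
    generalize σ .bool x = a at *
    generalize σ .bool y = b at *
    cases a; cases b
    simp only [Value.toBool] at h
    congr 1
    grind
  | adt a => exact hs.elim

/-- Where the equations hold, renaming by `ρ` does not change the values of the listed variables;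
linearization and the functionality rule both rest on this. -/
theorem Constraint.holdsAt_withEqs (c : Constraint) (ρ : S.Srt → ℕ → ℕ) (l : List (Var S))
    (hl : ∀ v ∈ l, v.ty.IsBasic) {σ : Valuation S} (h : (c.withEqs ρ l).HoldsAt σ) :
    c.HoldsAt σ ∧ ∀ v ∈ l, σ v.ty v.idx = σ v.ty (ρ v.ty v.idx) := by
  induction l with
  | nil => exact ⟨h, by simp⟩
  | cons v l ih =>
    obtain ⟨h₁, h₂⟩ := (Constraint.holdsAt_and _ _ σ).1 h
    obtain ⟨hc, hl'⟩ := ih (fun w hw => hl w (List.mem_cons_of_mem _ hw)) h₂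
    refine ⟨hc, fun w hw => ?_⟩
    rcases List.mem_cons.1 hw with rfl | hw
    · exact Constraint.eq_of_varEq (hl w (by simp)) h₁
    · exact hl' w hw

/-! ### Atoms that are tuples of variables -/

theorem Atom.IsTuple.vars_eq {A : Atom S} {U : Set (Var S)} (h : A.IsTuple U) : A.vars = U := by
  obtain ⟨x, hx, -, rfl⟩ := h
  ext v
  simp only [Atom.vars, hx, Term.vars, Set.mem_iUnion, Set.mem_singleton_iff, Set.mem_range,
    eq_comm]

/-- Every variable of such an atom is itself an argument. This converts the equality of argument
values given by a completed definition into agreement on variables. -/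
theorem Atom.IsTuple.agreeOn {A : Atom S} {U : Set (Var S)} (h : A.IsTuple U) {σ τ : Valuation S}
    (he : ∀ i, (A.args i).eval σ = (A.args i).eval τ) : AgreeOn A.vars σ τ := by
  rw [h.vars_eq]
  obtain ⟨x, hx, -, rfl⟩ := h
  rintro _ ⟨i, rfl⟩
  simpa [hx, Term.eval] using he i

/-! ### Least models -/

theorem leastModel_le {P : Set (Clause S)} {I : Interp S} (h : IsModel I P) {p : S.Pred}
    {a : ∀ i : Fin (S.predArgs p).length, Value S ((S.predArgs p).get i)}
    (ha : leastModel P p a) : I p a := ha I h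

/-- Truth of definite clauses is preserved by intersecting models. Goals have to be excluded: if
there is no model at all, `leastModel` is everywhere true. -/
theorem isModel_leastModel {P : Set (Clause S)} (hP : ∀ C ∈ P, C.head ≠ none) :
    IsModel (leastModel P) P := by
  intro C hC σ hc hB
  obtain ⟨A, hA⟩ := Option.ne_none_iff_exists'.1 (hP C hC)
  rw [hA]
  intro I hI
  have := hI C hC σ hc fun A' hA' => hB A' hA' I hI
  rwa [hA] at this

theorem Conj.Holds.mono {I J : Interp S} (h : ∀ p a, I p a → J p a) {σ : Valuation S} {G : Conj S}
    (hG : Conj.Holds I σ G) : Conj.Holds J σ G := fun A hA => h _ _ (hG A hA)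

/-- Totality only asserts that true instances exist, so it passes from a least model to every
interpretation above it. -/
theorem Total.mono {I J : Interp S} (h : ∀ p a, I p a → J p a) {F : Conj S} {Y : Set (Var S)}
    (hF : Total I F Y) : Total J F Y := fun σ =>
  let ⟨τ, h₁, h₂⟩ := hF σ
  ⟨τ, h₁, h₂.mono h⟩

/-! ### Definitions of new predicates -/

/-- The definitions in `Defs` define distinct predicates, not occurring in `Cls`, in terms of
predicates occurring in `Cls`. -/
structure IsDefSystem (Cls Defs : Set (Clause S)) : Prop where
  head_ne_none : ∀ D ∈ Defs, D.head ≠ none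
  head_new : ∀ D ∈ Defs, ∀ K ∈ D.head, K.pred ∉ predsOf Cls
  body_old : ∀ D ∈ Defs, ∀ A ∈ D.body, A.pred ∈ predsOf Cls
  unique : ∀ D ∈ Defs, ∀ K ∈ D.head, ∀ D' ∈ Defs, ∀ K' ∈ D'.head, K.pred = K'.pred → D = D'

theorem IsDefSystem.empty (Cls : Set (Clause S)) : IsDefSystem Cls ∅ := by
  constructor <;> simp

/-- Freshness with respect to `Cls` rules out recursion through the new predicate, and freshness
with respect to `Defs` keeps definitions unique. -/
theorem IsDefSystem.insert {P : Params S} {Cls Defs : Set (Clause S)} (h : IsDefSystem Cls Defs)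
    {U : Set (Var S)} {K : Atom S} {c : Constraint} {B : Conj S}
    (hK : IsNewDef P Cls Defs U K c B) : IsDefSystem Cls (Defs ∪ {⟨some K, c, B⟩}) := by
  obtain ⟨-, hnew, hB, -, -⟩ := hK
  have hCls : K.pred ∉ predsOf Cls := fun ⟨C, hC, h⟩ => hnew ⟨C, .inl hC, h⟩
  have hDefs : ∀ D ∈ Defs, ∀ K' ∈ D.head, K'.pred ≠ K.pred :=
    fun D hD K' hK' he => hnew ⟨D, .inr hD, .inl ⟨K', hK', he⟩⟩
  constructor
  · rintro D (hD | rfl)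
    exacts [h.head_ne_none D hD, by simp]
  · rintro D (hD | rfl) K' hK'
    · exact h.head_new D hD K' hK'
    · cases hK'; exact hCls
  · rintro D (hD | rfl)
    exacts [h.body_old D hD, hB]
  · rintro D (hD | rfl) K₁ hK₁ D' (hD' | rfl) K₂ hK₂ he
    · exact h.unique D hD K₁ hK₁ D' hD' K₂ hK₂ he
    · cases hK₂; exact (hDefs D hD K₁ hK₁ he).elim
    · cases hK₁; exact (hDefs D' hD' K₂ hK₂ he.symm).elim
    · rfl

/-- The least model of the definite clauses of `Cls`, extended to the predicates not occurring
in `Cls` by the completion of the definitions in `Defs`. -/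
def defModel (Cls Defs : Set (Clause S)) : Interp S := fun p a =>
  (p ∈ predsOf Cls ∧ leastModel (definite Cls) p a) ∨
  (p ∉ predsOf Cls ∧ ∃ D ∈ Defs, ∃ K ∈ D.head, ∃ σ : Valuation S,
    (⟨p, a⟩ : (p : S.Pred) × (∀ i : Fin (S.predArgs p).length, Value S ((S.predArgs p).get i))) =
      ⟨K.pred, fun i => (K.args i).eval σ⟩ ∧
    D.constr.HoldsAt σ ∧ Conj.Holds (leastModel (definite Cls)) σ D.body)

/-! ### Truth and completion in the model of the definitions -/

section DefModel

variable {Cls Defs : Set (Clause S)}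

theorem defModel_iff_of_mem {p : S.Pred} (hp : p ∈ predsOf Cls)
    (a : ∀ i : Fin (S.predArgs p).length, Value S ((S.predArgs p).get i)) :
    defModel Cls Defs p a ↔ leastModel (definite Cls) p a := by
  simp [defModel, hp]

theorem Conj.holds_defModel_iff {G : Conj S} (hG : ∀ A ∈ G, A.pred ∈ predsOf Cls)
    (σ : Valuation S) :
    Conj.Holds (defModel Cls Defs) σ G ↔ Conj.Holds (leastModel (definite Cls)) σ G :=
  forall₂_congr fun A hA => defModel_iff_of_mem (hG A hA) _

theorem isModel_defModel (hsat : Satisfiable Cls) (hD : IsDefSystem Cls Defs) :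
    IsModel (defModel Cls Defs) (Cls ∪ Defs) := by
  obtain ⟨I, hI⟩ := hsat
  have hI' : IsModel I (definite Cls) := fun C hC => hI C hC.1
  rintro C (hC | hC) σ hc hB
  · have hbody : ∀ A ∈ C.body, A.pred ∈ predsOf Cls := fun A hA => ⟨C, hC, .inr ⟨A, hA, rfl⟩⟩
    rw [Conj.holds_defModel_iff hbody] at hB
    cases hH : C.head with
    | none =>
      -- A goal violated in the least model would be violated in the larger model `I` of `Cls`.
      have := hI C hC σ hc (hB.mono fun p a => leastModel_le hI')
      rwa [hH] at this
    | some A =>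
      refine (defModel_iff_of_mem ⟨C, hC, .inl ⟨A, hH, rfl⟩⟩ _).2 ?_
      have := isModel_leastModel (P := definite Cls) (fun C hC => hC.2) C ⟨hC, by simp [hH]⟩ σ hc hB
      rwa [hH] at this
  · rw [Conj.holds_defModel_iff (hD.body_old C hC)] at hB
    obtain ⟨K, hK⟩ := Option.ne_none_iff_exists'.1 (hD.head_ne_none C hC)
    rw [hK]
    exact .inr ⟨hD.head_new C hC K hK, C, hC, K, hK, σ, rfl, hc, hB⟩

/-- In `I`, the atom `K` implies the body `d, B` of its definition, with the variables that do not
occur in `K` existentially quantified. -/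
def IsCompleted (I : Interp S) (K : Atom S) (d : Constraint) (B : Conj S) : Prop :=
  ∀ σ, K.Holds I σ → ∃ τ, (∀ i, (K.args i).eval σ = (K.args i).eval τ) ∧
    d.HoldsAt τ ∧ Conj.Holds I τ B

/-- A new predicate has just one definition, so its truth in `defModel` can only come from the body
of that definition. -/
theorem isCompleted_defModel (hD : IsDefSystem Cls Defs) {K : Atom S} {d : Constraint}
    {B : Conj S} (h : (⟨some K, d, B⟩ : Clause S) ∈ Defs) :
    IsCompleted (defModel Cls Defs) K d B := by
  rintro σ (⟨hp, -⟩ | ⟨-, D', hD', K', hK', τ, he, hc, hB⟩)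
  · exact (hD.head_new _ h K rfl hp).elim
  · have hp : K.pred = K'.pred := congrArg Sigma.fst he
    obtain rfl := hD.unique _ h K rfl D' hD' K' hK' hp
    obtain rfl : K = K' := Option.some.inj hK'
    refine ⟨τ, fun i => ?_, hc, (Conj.holds_defModel_iff (hD.body_old _ h) τ).2 hB⟩
    exact congrFun (eq_of_heq (Sigma.mk.inj he).2) i

/-- A renaming is a bijection of the variables, so the witnesses can be transported along its
inverse. -/
theorem IsCompleted.of_variant {I : Interp S} {K : Atom S} {d : Constraint} {B : Conj S}
    {K' : Atom S} {d' : Constraint} {B' : Conj S} (h : IsCompleted I K d B)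
    (hv : IsVariant ⟨some K', d', B'⟩ ⟨some K, d, B⟩) : IsCompleted I K' d' B' := by
  obtain ⟨ρ, hρ⟩ := hv
  simp only [Clause.subst, Option.map_some, Clause.mk.injEq, Option.some.injEq] at hρ
  obtain ⟨rfl, rfl, rfl⟩ := hρ
  intro σ hσ
  obtain ⟨τ, hK, hd, hB⟩ := h _ ((K.holds_subst I _ σ).1 hσ)
  have hp : ρ.toSubst.pull (fun s x => τ s ((ρ s).symm x)) = τ := by
    funext s x
    simp [Subst.pull, Renaming.toSubst, Subst.ofMap, Term.eval]
  refine ⟨fun s x => τ s ((ρ s).symm x), fun i => ?_, ?_, ?_⟩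
  · exact (Term.eval_subst _ _ (K.args i)).trans ((hK i).trans
      ((congrArg (fun υ => (K.args i).eval υ) hp.symm).trans (Term.eval_subst _ _ (K.args i)).symm))
  · rw [Constraint.holdsAt_subst, hp]; exact hd
  · rw [Conj.holds_subst, hp]; exact hB

theorem IsDefVariant.isCompleted (hD : IsDefSystem Cls Defs) {defs : Set (Clause S)}
    (hsub : defs ⊆ Defs) {K : Atom S} {d : Constraint} {B : Conj S} (h : IsDefVariant defs K d B) :
    IsCompleted (defModel Cls Defs) K d B := by
  obtain ⟨⟨⟨H, d', B'⟩, hmem, hv⟩, -⟩ := h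
  obtain ⟨K', rfl⟩ := Option.ne_none_iff_exists'.1 (hD.head_ne_none _ (hsub hmem))
  exact (isCompleted_defModel hD (hsub hmem)).of_variant hv

/-- The model of the definitions `Defs` is below any model of `Ds` on the predicates whose
definition is true in the model. -/
theorem Atom.Holds.of_defModel (hD : IsDefSystem Cls Defs) {J : Interp S} {K : Atom S}
    {d : Constraint} {B : Conj S} (hmem : (⟨some K, d, B⟩ : Clause S) ∈ Defs)
    (hJ : IsModel J (definite Cls)) (hC : Clause.IsTrue J ⟨some K, d, B⟩)
    {σ : Valuation S} (h : K.Holds (defModel Cls Defs) σ) : K.Holds J σ := by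
  obtain ⟨τ, hK, hd, hB⟩ := isCompleted_defModel hD hmem σ h
  have : K.Holds J τ := hC τ hd
    (((Conj.holds_defModel_iff (hD.body_old _ hmem) τ).1 hB).mono fun p a => leastModel_le hJ)
  rw [Atom.Holds, ← funext hK] at this
  exact this

end DefModel

/-! ### Folding and differential replacement -/

/-- Completion gives values to the variables of `B` that do not occur in `K`. By Condition (E) these
are sent to distinct variables foreign to the rest of the clause, so the valuation can be altered
there to make the instance of `B` true while `H`, `c` and `G` keep their values. -/
theorem isTrue_fold {I : Interp S} {H : Option (Atom S)} {c : Constraint} {G : Conj S}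
    {K : Atom S} {d : Constraint} {B : Conj S} {θ : Subst S} {U : Set (Var S)}
    (hC : Clause.IsTrue I ⟨H, c, B.subst θ + G⟩) (hcomp : IsCompleted I K d B)
    (hK : K.IsTuple U) (hU : ∀ v ∈ U, θ v.ty v.idx = .var v.idx)
    (hE : ConditionE H c G K d B θ) : Clause.IsTrue I ⟨H, c, K ::ₘ G⟩ := by
  classical
  intro σ hc hKG
  obtain ⟨hσK, hσG⟩ := (Conj.holds_cons I σ K G).1 hKG
  obtain ⟨σ', he, hd, hB⟩ := hcomp σ hσK
  have hag := hK.agreeOn he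
  let E : Set (Var S) := (d.vars S ∪ B.vars) \ K.vars
  let Q : (s : S.Srt) → ℕ → ℕ → Prop := fun s z x =>
    (⟨s, x⟩ : Var S) ∈ E ∧ θ s x = .var z
  -- The altered valuation: `σ'` is copied to the images under `θ` of the variables missing from
  -- `K`, and `σ` is kept elsewhere.
  let τ : Valuation S := fun s z => if h : ∃ x, Q s z x then σ' s h.choose else σ s z
  have hτE : ∀ s x z, Q s z x → τ s z = σ' s x := by
    intro s x z hx
    have hex : ∃ x, Q s z x := ⟨x, hx⟩
    have hch := hex.choose_spec
    -- The choice is immaterial: two variables with the same image would contradict the last part of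
    -- Condition (E).
    have hxx : hex.choose = x := by
      by_contra hne
      obtain ⟨z', hz', -, hz₂⟩ := hE _ hx.1
      have hzz : z' = z := by
        have := hz'.symm.trans hx.2
        simpa using this
      subst hzz
      refine hz₂ ⟨s, hex.choose⟩ hch.1.1 (fun h => hne (congrArg Var.idx h)) ?_
      simp only [hch.2, Term.vars, Set.mem_singleton_iff]
    simp only [τ, dif_pos hex, hxx]
  have hτ : ∀ v : Var S, (∀ x, ¬ Q v.ty v.idx x) → τ v.ty v.idx = σ v.ty v.idx := by
    intro v hv
    have : ¬ ∃ x, Q v.ty v.idx x := by simpa using hv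
    simp only [τ, dif_neg this]
  have hctx : AgreeOn (headVars H ∪ c.vars S ∪ G.vars) τ σ := by
    intro v hv
    refine hτ v fun x hx => ?_
    obtain ⟨z, hz, hz₁, -⟩ := hE _ hx.1
    have hzz : z = v.idx := by simpa using hz.symm.trans hx.2
    subst hzz
    exact hz₁ hv
  -- On the variables of `K`, `θ` is the identity and `σ'` agrees with `σ`; on the others the
  -- agreement holds by the construction of `τ`.
  have hpull : AgreeOn B.vars (θ.pull τ) σ' := by
    intro v hv
    by_cases hvK : v ∈ K.vars
    · have hθ := hU v (hK.vars_eq ▸ hvK)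
      simp only [Subst.pull, hθ, Term.eval]
      rw [← hag v hvK]
      refine hτ v fun x hx => ?_
      obtain ⟨z, hz, -, hz₂⟩ := hE _ hx.1
      have hzz : z = v.idx := by simpa using hz.symm.trans hx.2
      subst hzz
      refine hz₂ v (.inr hv) (fun h => hx.1.2 (h ▸ hvK)) ?_
      rw [hθ]
      rfl
    · obtain ⟨z, hz, -⟩ := hE v ⟨.inr hv, hvK⟩
      simp only [Subst.pull, hz, Term.eval]
      exact hτE v.ty v.idx z ⟨⟨.inr hv, hvK⟩, hz⟩
  refine (headHolds_congr I H (hctx.mono fun v hv => .inl (.inl hv))).1 (hC τ ?_ ?_)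
  · exact (c.holdsAt_congr (hctx.mono fun v hv => .inl (.inr hv))).2 hc
  · refine (Conj.holds_add I τ _ _).2 ⟨?_, ?_⟩
    · exact (Conj.holds_subst I θ τ B).2 ((Conj.holds_congr I B hpull).2 hB)
    · exact (Conj.holds_congr I G (hctx.mono fun v hv => .inr hv)).2 hσG

/-- Totality lets `Y` be revalued so that `F` becomes true. What must be shown is that the rest of
the clause does not notice the new values, and the atom `K` is there to ensure this for the basic
variables. -/
theorem isTrue_replace {I : Interp S} {P : Params S} {H : Option (Atom S)} {c : Constraint}
    {F G R : Conj S} {K : Atom S} {X Y V W : Set (Var S)}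
    (hC : Clause.IsTrue I ⟨H, c, F + G⟩)
    (hdef : Clause.IsTrue I ⟨some K, P.proj c X, F + R⟩)
    (hXY : SplitsVars F X Y) (hVW : SplitsVars R V W) (htot : Total I F Y)
    (hW : Disjoint W Y) (hYV : Y ∩ (V ∪ (P.proj c X).vars S) = ∅)
    (hfun : Functional I {K} (bvars (X ∪ V) ∪ bvars W) (bvars Y))
    (hadt : adtVars Y ∩ adtVars (headVars H ∪ c.vars S ∪ Conj.vars G) = ∅) :
    Clause.IsTrue I ⟨H, c, K ::ₘ (R + G)⟩ := by
  intro σ hc hB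
  obtain ⟨hK, hRG⟩ := (Conj.holds_cons I σ _ _).1 hB
  obtain ⟨hR, hG⟩ := (Conj.holds_add I σ _ _).1 hRG
  obtain ⟨τ, hστ, hF⟩ := htot σ
  have hV : ∀ v ∈ V, v ∉ Y := fun v hv hY => (hYV ▸ ⟨hY, .inl hv⟩ : v ∈ (∅ : Set (Var S)))
  have hW' : ∀ v ∈ W, v ∉ Y := fun v hv hY => Set.disjoint_left.1 hW hv hY
  have hX : ∀ v ∈ X, v ∉ Y := fun v hv hY => Set.disjoint_left.1 hXY.1 hv hY
  have hRτ : Conj.Holds I τ R := by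
    refine (Conj.holds_congr I R (hστ.mono fun v hv => ?_)).1 hR
    rw [hVW.2] at hv
    exact hv.elim (hV v) (hW' v)
  have hKτ : K.Holds I τ := by
    refine hdef τ ?_ ((Conj.holds_add I τ _ _).2 ⟨hF, hRτ⟩)
    -- The projected constraint mentions only variables of `X`, which the revaluation of `Y` leaves
    -- alone.
    refine (Constraint.holdsAt_congr _ (hστ.mono fun v hv hY => ?_)).1
      ((P.proj_entails c X).holdsAt hc)
    exact hX v (P.proj_vars c X hv) hY
  -- `K` holds at `σ` by assumption and at `τ` by its definition, and the two valuations agree on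
  -- its inputs.
  have hYb : AgreeOn (bvars Y) σ τ := by
    refine hfun σ τ (hστ.mono ?_) (by simpa [Conj.Holds] using hK) (by simpa [Conj.Holds] using hKτ)
    rintro v (⟨hv | hv, -⟩ | ⟨hv, -⟩)
    exacts [hX v hv, hV v hv, hW' v hv]
  have hctx : AgreeOn (headVars H ∪ c.vars S ∪ Conj.vars G) σ τ := by
    intro v hv
    by_cases hY : v ∈ Y
    · by_cases hb : v.ty.IsBasic
      · exact hYb v ⟨hY, hb⟩
      · exact ((hadt ▸ ⟨⟨hY, hb⟩, ⟨hv, hb⟩⟩ : v ∈ (∅ : Set (Var S)))).elim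
    · exact hστ v hY
  refine (headHolds_congr I H (hctx.mono fun v hv => .inl (.inl hv))).2 (hC τ ?_ ?_)
  · exact (c.holdsAt_congr (hctx.mono fun v hv => .inl (.inr hv))).1 hc
  · exact (Conj.holds_add I τ _ _).2
      ⟨hF, (Conj.holds_congr I G (hctx.mono fun v hv => .inr hv)).1 hG⟩

theorem Subst.ActsOnlyOn.eq_var_of_basic {θ : Subst S} {V : Set (Var S)}
    (h : θ.ActsOnlyOn (adtVars V)) {v : Var S} (hv : v.ty.IsBasic) :
    θ v.ty v.idx = .var v.idx := h _ _ fun hmem => hmem.2 hv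

theorem Term.subst_id {s : S.Srt} (t : Term S s) : t.subst Subst.id = t := by
  induction t with
  | var x => rfl
  | con k args ih => simp only [Term.subst, ih]

theorem Conj.subst_id (G : Conj S) : Conj.subst Subst.id G = G := by
  have : Atom.subst (Subst.id : Subst S) = _root_.id := by
    funext A
    simp only [Atom.subst, Term.subst_id, id]
  rw [Conj.subst, this, Multiset.map_id]

/-! ### Procedure Diff-Define-Fold -/

theorem FoldStep.isDefSystem {P : Params S} {Cls Defs : Set (Clause S)} {s t : FoldState S}
    {l : List (RuleApp S)} (h : FoldStep P Cls Defs s l t)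
    (hs : IsDefSystem Cls (Defs ∪ s.newDefs)) : IsDefSystem Cls (Defs ∪ t.newDefs) := by
  cases h with
  | basic => exact hs
  | fold => simpa [FoldState.update] using hs
  | generalize H c B G' K d B' θ K₁ _ _ _ _ h₁ =>
    simpa [FoldState.update, Set.union_assoc] using hs.insert h₁
  | diffFold H c B G' K d B' M F X Y θ R V W K₀ _ _ _ _ h₁ =>
    simpa [FoldState.update, Set.union_assoc] using hs.insert h₁
  | diffGeneralize H c B G' K d B' M F X Y θ R V W K₀ K₁ _ _ _ _ h₁ _ h₂ =>
    have := (hs.insert h₁).insert h₂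
    rwa [Set.union_assoc, Set.union_assoc, Set.singleton_union] at this
  | project H c B G' K _ _ _ _ h₁ =>
    simpa [FoldState.update, Set.union_assoc] using hs.insert h₁

theorem FoldStep.newDefs_subset {P : Params S} {Cls Defs : Set (Clause S)} {s t : FoldState S}
    {l : List (RuleApp S)} (h : FoldStep P Cls Defs s l t) : s.newDefs ⊆ t.newDefs := by
  cases h <;> first | exact subset_rfl | exact Set.subset_union_left

/-- All the clauses of the state that are still to be processed or have been moved to the output
are true in `I`. -/
def FoldState.IsTrue (I : Interp S) (s : FoldState S) : Prop := IsModel I (s.inCls ∪ s.fldCls)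

theorem FoldState.IsTrue.update {I : Interp S} {s : FoldState S} (h : s.IsTrue I) {C E : Clause S}
    {N : Set (Clause S)} (hE : E.IsTrue I) : (s.update C E N).IsTrue I := by
  rintro D ((hD | rfl) | hD)
  exacts [h D (.inl hD.1), hE, h D (.inr hD)]

/-- Differential replacement followed by folding, as in the case (Diff-Introduce), preserves truth
in the model of the definitions. -/
theorem isTrue_diffIntroduce {P : Params S} {Cls defs All : Set (Clause S)}
    (hsat : Satisfiable Cls) (hAll : IsDefSystem Cls All)
    {H : Option (Atom S)} {c : Constraint} {B G' : Conj S} {K : Atom S} {d : Constraint}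
    {B' M F : Conj S} {X Y : Set (Var S)} {θ : Subst S} {R : Conj S} {V W : Set (Var S)}
    {K₀ K₁ : Atom S} {d₁ : Constraint}
    (hmatch : PartialMatch P (definite Cls) defs H c B G' K d B' M F X Y θ R V W)
    (hsub : defs ∪ {⟨some K₀, P.proj c X, F + R⟩} ⊆ All)
    (hF : ConditionF (definite Cls) H c (M + G') K₀ (P.proj c X) X Y V W
      (defs ∪ {⟨some K₀, P.proj c X, F + R⟩}))
    (hE : ConditionE H c (K₀ ::ₘ G') K₁ d₁ B' θ)
    (hcomp : IsCompleted (defModel Cls All) K₁ d₁ B')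
    (hK₁ : K₁.IsTuple (bvars (d.vars S ∪ B'.vars)))
    (hC : Clause.IsTrue (defModel Cls All) ⟨H, c, B + G'⟩) :
    Clause.IsTrue (defModel Cls All) ⟨H, c, K₁ ::ₘ K₀ ::ₘ G'⟩ := by
  obtain ⟨-, -, -, rfl, -, hθ, hB', hFtf, hRtf, hW, -⟩ := hmatch
  obtain ⟨hfun, hYV, hadt⟩ := hF
  have hmodel := isModel_defModel hsat hAll
  have hmem : (⟨some K₀, P.proj c X, F + R⟩ : Clause S) ∈ All := hsub (.inr rfl)
  -- Least models of earlier definitions lie below the fixed model, so totality lifts.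
  have hle : ∀ D ⊆ All, ∀ p a, leastModel (definite Cls ∪ D) p a → defModel Cls All p a := by
    intro D hD p a
    refine leastModel_le fun C hC => ?_
    exact hC.elim (fun h => hmodel C (.inl h.1)) (fun h => hmodel C (.inr (hD h)))
  have hlm : IsModel (leastModel (definite Cls ∪ (defs ∪ {⟨some K₀, P.proj c X, F + R⟩})))
      (definite Cls ∪ (defs ∪ {⟨some K₀, P.proj c X, F + R⟩})) :=
    isModel_leastModel fun C hC =>
      hC.elim (fun h => h.2) (fun h => hAll.head_ne_none C (hsub h))
  -- Functionality needs the opposite inclusion. It holds for `K₀`, whose body involves only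
  -- predicates of `Cls`: a body true in the fixed model is true in every model of the definite
  -- clauses.
  have hK₀ : ∀ σ, Conj.Holds (defModel Cls All) σ {K₀} → Conj.Holds
      (leastModel (definite Cls ∪ (defs ∪ {⟨some K₀, P.proj c X, F + R⟩}))) σ {K₀} := by
    intro σ hσ A hA
    obtain rfl := Multiset.mem_singleton.1 hA
    exact (hσ A hA).of_defModel hAll hmem (fun C hC => hlm C (.inl hC)) (hlm _ (.inr (.inr rfl)))
  have hrep : Clause.IsTrue (defModel Cls All) ⟨H, c, K₀ ::ₘ (R + (M + G'))⟩ := by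
    refine isTrue_replace (P := P) (F := F) ?_ (hmodel _ (.inr hmem)) hFtf.1 hRtf.1
      (hFtf.2.2.mono (hle defs (Set.subset_union_left.trans hsub))) ?_ hYV
      (fun σ τ h hσ hτ => hfun σ τ h (hK₀ σ hσ) (hK₀ τ hτ)) hadt
    · rwa [← add_assoc, add_comm F M]
    -- `Y` consists of variables of `F`, hence of the clause, and `W` avoids the clause.
    · refine (Set.disjoint_iff_inter_eq_empty.2 hW).mono_right fun v hv => ?_
      refine .inr ?_
      rw [Conj.vars_add, Conj.vars_add, hFtf.1.2]
      exact .inl (.inr (.inr hv))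
  refine isTrue_fold ?_ hcomp hK₁ (fun v hv => hθ.eq_var_of_basic hv.2) hE
  rwa [hB', Multiset.add_cons, add_comm M R, add_assoc]

/-- The definition used, old or just introduced, belongs to `All`, so it is already completed in the
one interpretation shared by all steps. -/
theorem FoldStep.isTrue {P : Params S} {Cls Defs All : Set (Clause S)} (hsat : Satisfiable Cls)
    (hAll : IsDefSystem Cls All) {s t : FoldState S}
    {l : List (RuleApp S)} (h : FoldStep P Cls Defs s l t) (hsub : Defs ∪ t.newDefs ⊆ All)
    (hE : ∀ a ∈ l, a.IsFold → a.FulfillsE) (hF : ∀ a ∈ l, ¬ a.IsFold → a.FulfillsF (definite Cls))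
    (hs : s.IsTrue (defModel Cls All)) : t.IsTrue (defModel Cls All) := by
  have hsub' : Defs ∪ s.newDefs ⊆ All :=
    (Set.union_subset_union_right _ h.newDefs_subset).trans hsub
  cases h with
  | basic C hC =>
    rintro D (hD | hD | rfl)
    exacts [hs D (.inl hD.1), hs D (.inr hD), hs D (.inl hC)]
  | fold H c B G' K d B' θ hsel hinst =>
    obtain ⟨hvar, hθ, rfl⟩ := hinst
    refine hs.update (isTrue_fold (hs _ (.inl hsel.1)) (hvar.isCompleted hAll hsub') hvar.2
      (fun v hv => hθ.eq_var_of_basic hv.2) ?_)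
    exact hE (.fold H c G' K d B' θ) (by simp) trivial
  | generalize H c B G' K d B' θ K₁ hsel _ hinst _ hnew =>
    obtain ⟨hvar, hθ, rfl⟩ := hinst
    refine hs.update (isTrue_fold (hs _ (.inl hsel.1))
      (isCompleted_defModel hAll (hsub (.inr (.inr rfl)))) hnew.1
      (fun v hv => hθ.eq_var_of_basic hv.2) ?_)
    exact hE (.fold H c G' K₁ (P.gen d c) B' θ) (by simp) trivial
  | diffFold H c B G' K d B' M F X Y θ R V W K₀ hsel _ _ hmatch hnew =>
    refine hs.update (isTrue_diffIntroduce hsat hAll hmatch.1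
      (Set.union_subset hsub' fun D hD => hsub (.inr (.inr hD))) ?_ ?_
      (hmatch.1.1.isCompleted hAll hsub') hmatch.1.1.2 (hs _ (.inl hsel.1)))
    · exact hF (.replace H c (M + G') K₀ (P.proj c X) X Y V W _) (by simp) id
    · exact hE (.fold H c (K₀ ::ₘ G') K d B' θ) (by simp) trivial
  | diffGeneralize H c B G' K d B' M F X Y θ R V W K₀ K₁ hsel _ _ hmatch hnew _ hnew' =>
    refine hs.update (isTrue_diffIntroduce hsat hAll hmatch.1
      (Set.union_subset hsub' fun D hD => hsub (.inr (.inr (.inl hD)))) ?_ ?_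
      (isCompleted_defModel hAll (hsub (.inr (.inr (.inr rfl))))) hnew'.1 (hs _ (.inl hsel.1)))
    · exact hF (.replace H c (M + G') K₀ (P.proj c X) X Y V W _) (by simp) id
    · exact hE (.fold H c (K₀ ::ₘ G') K₁ (P.gen d c) B' θ) (by simp) trivial
  | project H c B G' K hsel _ _ _ hnew =>
    refine hs.update (isTrue_fold (θ := Subst.id) ?_
      (isCompleted_defModel hAll (hsub (.inr (.inr rfl)))) hnew.1 (fun _ _ => rfl) ?_)
    · rw [Conj.subst_id]; exact hs _ (.inl hsel.1)
    · exact hE (.fold H c G' K _ B Subst.id) (by simp) trivial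

theorem foldSteps_isDefSystem {P : Params S} {Cls Defs : Set (Clause S)} {s t : FoldState S}
    {l : List (RuleApp S)} (h : Steps (FoldStep P Cls Defs) s l t)
    (hs : IsDefSystem Cls (Defs ∪ s.newDefs)) : IsDefSystem Cls (Defs ∪ t.newDefs) := by
  induction h with
  | refl => exact hs
  | step h _ ih => exact ih (h.isDefSystem hs)

theorem foldSteps_newDefs_subset {P : Params S} {Cls Defs : Set (Clause S)} {s t : FoldState S}
    {l : List (RuleApp S)} (h : Steps (FoldStep P Cls Defs) s l t) : s.newDefs ⊆ t.newDefs := by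
  induction h with
  | refl => exact subset_rfl
  | step h _ ih => exact h.newDefs_subset.trans ih

/-- Definitions only accumulate, so bounding the final ones by `All` bounds those of every
intermediate state. -/
theorem foldSteps_isTrue {P : Params S} {Cls Defs All : Set (Clause S)} (hsat : Satisfiable Cls)
    (hAll : IsDefSystem Cls All) {s t : FoldState S}
    {l : List (RuleApp S)} (h : Steps (FoldStep P Cls Defs) s l t) (hsub : Defs ∪ t.newDefs ⊆ All)
    (hE : ∀ a ∈ l, a.IsFold → a.FulfillsE) (hF : ∀ a ∈ l, ¬ a.IsFold → a.FulfillsF (definite Cls))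
    (hs : s.IsTrue (defModel Cls All)) : t.IsTrue (defModel Cls All) := by
  induction h with
  | refl => exact hs
  | step h h' ih =>
    refine ih hsub (fun a ha => hE a (List.mem_append_right _ ha))
      (fun a ha => hF a (List.mem_append_right _ ha)) ?_
    exact h.isTrue hsat hAll
      ((Set.union_subset_union_right _ (foldSteps_newDefs_subset h')).trans hsub)
      (fun a ha => hE a (List.mem_append_left _ ha))
      (fun a ha => hF a (List.mem_append_left _ ha)) hs

/-! ### Procedure Unfold -/

/-- Soundness of resolution: at the pulled valuation `A` and `K` are the same ground atom, so the
clause with head `K` supplies the missing body atom `A` of `C`. -/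
theorem Resolvent.isTrue {I : Interp S} {D : Clause S} {C : MClause S} {A : Atom S} {m u : Conj S}
    {R : MClause S} (h : Resolvent D C A m u R) (hbody : C.body = A ::ₘ (m + u))
    (hC : C.toClause.IsTrue I) (hD : D.IsTrue I) : R.toClause.IsTrue I := by
  obtain ⟨K, d, B, θ, ⟨ρ, hρ⟩, -, ⟨hmgu, -⟩, -, rfl⟩ := h
  have hKB : Clause.IsTrue I ⟨some K, d, B⟩ := hρ ▸ Clause.isTrue_subst hD ρ.toSubst
  intro σ hc hB
  obtain ⟨hc, hd⟩ := (Constraint.holdsAt_subst θ σ _).1 hc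
  have hB' : Conj.Holds I σ (m.subst θ) ∧ Conj.Holds I σ (Conj.subst θ (u + B)) :=
    (Conj.holds_add I σ _ _).1 hB
  rw [Conj.holds_subst, Conj.holds_subst, Conj.holds_add] at hB'
  obtain ⟨hm, hu, hB⟩ := hB'
  have hA : A.Holds I (θ.pull σ) := by
    have hK : K.Holds I (θ.pull σ) := hKB _ hd hB
    rwa [← Atom.holds_subst, ← show A.subst θ = K.subst θ from hmgu, Atom.holds_subst] at hK
  refine (headHolds_subst I θ σ C.head).2 (hC _ hc ?_)
  change Conj.Holds I _ C.body
  rw [hbody, Conj.holds_cons, Conj.holds_add]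
  exact ⟨hA, hm, hu⟩

theorem Linearizes.isTrue {I : Interp S} {R R' : MClause S} (h : Linearizes R R')
    (hR : R.toClause.IsTrue I) : R'.toClause.IsTrue I := by
  obtain ⟨-, -, N, ρ, -, hN, hρ, -, hhead, hm, hu, hc⟩ := h
  intro σ hcσ hB
  change R'.constr.HoldsAt σ at hcσ
  rw [hc] at hcσ
  obtain ⟨hcσ, heq⟩ := Constraint.holdsAt_withEqs _ ρ N (fun v hv => (hN v hv).1) hcσ
  have hpull : (Subst.ofMap ρ).pull σ = σ := by
    funext s x
    by_cases hv : (⟨s, x⟩ : Var S) ∈ N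
    · exact (heq _ hv).symm
    · exact congrArg (σ s) (hρ _ hv)
  have hB' : Conj.Holds I σ R.body := by
    rw [MClause.body, ← hm, ← hu, Conj.holds_add, Conj.holds_subst, Conj.holds_subst, hpull,
      ← Conj.holds_add]
    exact hB
  have := hR σ hcσ hB'
  change headHolds I σ R.head at this
  rwa [← hhead, headHolds_subst, hpull] at this

/-- Leaving `picks` arbitrary, subject to a correct splitting of the body, serves both phases at
once. -/
theorem UnfoldPhase.isTrue {I : Interp S} {Ds : Set (Clause S)}
    {picks : MClause S → Atom S → Conj S → Conj S → Prop} {s t : Set (MClause S)}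
    (h : UnfoldPhase Ds picks s t)
    (hpicks : ∀ C A m u, picks C A m u → C.body = A ::ₘ (m + u)) (hDs : IsModel I Ds)
    (hs : ∀ C ∈ s, C.toClause.IsTrue I) : ∀ C ∈ t, C.toClause.IsTrue I := by
  refine Relation.ReflTransGen.rec hs ?_ h.1
  rintro s t - ⟨C, hC, A, m, u, U, hp, ⟨f, hf, rfl⟩, rfl⟩ ih E (hE | ⟨D, ⟨hD, hex⟩, rfl⟩)
  · exact ih E hE.1
  · obtain ⟨R, hR, he⟩ := hf D hD hex
    have hRt := hR.isTrue (hpicks _ _ _ _ hp) (ih C hC) (hDs D hD)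
    exact he.elim (fun h => h ▸ hRt) (fun h => h.isTrue hRt)

theorem MClause.PicksMarked.body_eq {C : MClause S} {A : Atom S} {m u : Conj S}
    (h : C.PicksMarked A m u) : C.body = A ::ₘ (m + u) := by
  rw [MClause.body, h.1, h.2, Multiset.cons_add]

theorem MClause.PicksUnmarked.body_eq {C : MClause S} {A : Atom S} {m u : Conj S}
    (h : C.PicksUnmarked A m u) : C.body = A ::ₘ (m + u) := by
  rw [MClause.body, h.1, h.2, Multiset.add_cons]

theorem Unfold.isModel {I : Interp S} {P : Params S} {Ds NewDefs UnfCls : Set (Clause S)}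
    (h : Unfold P Ds NewDefs UnfCls) (hDs : IsModel I Ds) (hN : IsModel I NewDefs) :
    IsModel I UnfCls := by
  obtain ⟨mark, s₁, s₂, hmark, h₁, h₂, rfl⟩ := h
  have hs₁ : ∀ C ∈ s₁, C.toClause.IsTrue I := by
    refine h₁.isTrue (fun _ _ _ _ hp => hp.body_eq) hDs ?_
    rintro _ ⟨C, hC, rfl⟩
    exact (hmark C hC).1.symm ▸ hN C hC
  rintro _ ⟨C, hC, rfl⟩
  refine h₂.isTrue (fun _ _ _ _ hp => hp.2.elim (·.body_eq) (·.1.body_eq)) hDs ?_ C hC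
  rintro _ ⟨C, hC, rfl⟩
  have : C.markAll.toClause = C.toClause := by
    simp [MClause.markAll, MClause.toClause, MClause.body]
  exact this ▸ hs₁ C hC

/-! ### Procedure Replace -/

/-- Wherever the new constraint holds, the equations `Y = Z` identify the two copies of `F`, so one
copy is enough to apply the old clause. -/
theorem FunctionalityStep.isModel {I : Interp S} {Ds s t : Set (Clause S)}
    (h : FunctionalityStep Ds s t) (hs : IsModel I s) : IsModel I t := by
  obtain ⟨H, c, F, G, X, Y, ζ, l, θ, hmem, -, -, -, hζ, -, -, -, hl, ⟨hθ, -⟩, rfl⟩ := h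
  rintro C (hC | rfl)
  · exact hs C hC.1
  intro σ hc hB
  have hc := (Constraint.holdsAt_subst θ σ _).1 hc
  have hB := (Conj.holds_subst I θ σ _).1 hB
  obtain ⟨hc, heq⟩ := Constraint.holdsAt_withEqs _ ζ l (fun v hv => ((hl v).1 hv).2) hc
  -- Basic variables of `Y` are handled by the added equations, ADT variables by the unifier, and
  -- `ζ` fixes all others.
  have hpull : (Subst.ofMap ζ).pull (θ.pull σ) = θ.pull σ := by
    funext s x
    by_cases hv : (⟨s, x⟩ : Var S) ∈ Y
    · by_cases hb : s.IsBasic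
      · exact (heq ⟨s, x⟩ ((hl _).2 ⟨hv, hb⟩)).symm
      · exact congrArg (Term.eval σ) (hθ ⟨s, x⟩ ⟨hv, hb⟩).symm
    · exact congrArg (θ.pull σ s) (hζ _ hv)
  obtain ⟨hF, hG⟩ := (Conj.holds_add I _ _ _).1 hB
  refine (headHolds_subst I θ σ H).2 (hs _ hmem _ hc ?_)
  simp only [Conj.holds_add, Conj.holds_subst, hpull]
  exact ⟨⟨hF, hF⟩, hG⟩

/-- As a model of `s ∪ Ds`, `I` lies above its least model and inherits totality. The values found
for `Y` restore `F` without affecting the clause that remains. -/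
theorem TotalityStep.isModel {I : Interp S} {Ds s t : Set (Clause S)}
    (h : TotalityStep Ds s t) (hDs : IsModel I Ds) (hs : IsModel I s) : IsModel I t := by
  obtain ⟨H, c, F, G, X, Y, hmem, -, -, htot, hY, rfl⟩ := h
  rintro C (hC | rfl)
  · exact hs C hC.1
  intro σ hc hG
  have hle : ∀ p a, leastModel (s ∪ Ds) p a → I p a := fun p a =>
    leastModel_le fun C hC => hC.elim (hs C) (hDs C)
  obtain ⟨τ, hστ, hF⟩ := htot.mono hle σ
  have hctx : AgreeOn (Clause.vars ⟨H, c, G⟩) σ τ :=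
    hστ.mono fun v hv hvY => (hY ▸ ⟨hvY, hv⟩ : v ∈ (∅ : Set (Var S)))
  refine (headHolds_congr I H (hctx.mono fun v hv => .inl (.inl hv))).2 (hs _ hmem τ ?_ ?_)
  · exact (c.holdsAt_congr (hctx.mono fun v hv => .inl (.inr hv))).1 hc
  · exact (Conj.holds_add I τ _ _).2
      ⟨hF, (Conj.holds_congr I G (hctx.mono fun v hv => .inr hv)).1 hG⟩

theorem Replace.isModel {I : Interp S} {Ds UnfCls RCls : Set (Clause S)}
    (h : Replace Ds UnfCls RCls) (hDs : IsModel I Ds) (hU : IsModel I UnfCls) :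
    IsModel I RCls := by
  refine Relation.ReflTransGen.rec hU ?_ h.1
  rintro s t - ⟨s₁, s₂, h₁, h₂, h₃⟩ hs
  have hs₁ : IsModel I s₁ := by
    rcases h₁ with ⟨C, -, -, rfl⟩ | ⟨-, rfl⟩
    exacts [fun D hD => hs D hD.1, hs]
  have hs₂ : IsModel I s₂ := by
    rcases h₂ with h | ⟨-, rfl⟩
    exacts [h.isModel hs₁, hs₁]
  rcases h₃ with h | ⟨-, rfl⟩
  exacts [h.isModel hDs hs₂, hs₂]

/-! ### The algorithm -/

theorem Iteration.isDefSystem {P : Params S} {Cls : Set (Clause S)} {s t : AlgState S}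
    {l : List (RuleApp S)} (h : Iteration P Cls s l t) (hs : IsDefSystem Cls s.defs) :
    IsDefSystem Cls t.defs := by
  obtain ⟨-, _, _, _, _, h, -, -, rfl⟩ := h
  exact foldSteps_isDefSystem h (by simpa using hs)

theorem Iteration.defs_subset {P : Params S} {Cls : Set (Clause S)} {s t : AlgState S}
    {l : List (RuleApp S)} (h : Iteration P Cls s l t) : s.defs ⊆ t.defs := by
  obtain ⟨-, _, _, _, _, -, -, -, rfl⟩ := h
  exact Set.subset_union_left

/-- The clauses for the next iteration descend from the new definitions, which are true in the fixed
model by construction; the processed clauses survive only in folded form. -/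
theorem Iteration.isModel {P : Params S} {Cls All : Set (Clause S)} (hsat : Satisfiable Cls)
    (hAll : IsDefSystem Cls All) {s t : AlgState S} {l : List (RuleApp S)}
    (h : Iteration P Cls s l t) (hsub : t.defs ⊆ All)
    (hE : ∀ a ∈ l, a.IsFold → a.FulfillsE) (hF : ∀ a ∈ l, ¬ a.IsFold → a.FulfillsF (definite Cls))
    (hs : IsModel (defModel Cls All) (s.inCls ∪ s.transfCls)) :
    IsModel (defModel Cls All) (t.inCls ∪ t.transfCls) := by
  obtain ⟨-, NewDefs, FldCls, UnfCls, RCls, hfold, hunf, hrep, rfl⟩ := h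
  have hmodel := isModel_defModel hsat hAll
  have hDs : IsModel (defModel Cls All) (definite Cls) := fun C hC => hmodel C (.inl hC.1)
  have hN : IsModel (defModel Cls All) NewDefs := fun C hC => hmodel C (.inr (hsub (.inr hC)))
  have hfld := foldSteps_isTrue hsat hAll hfold hsub hE hF (by
    rintro C (hC | hC)
    exacts [hs C (.inl hC), hC.elim])
  rintro C (hC | hC | hC)
  exacts [hrep.isModel hDs (hunf.isModel hDs hN) C hC, hs C (.inr hC), hfld C (.inr hC)]

theorem iterations_isDefSystem {P : Params S} {Cls : Set (Clause S)} {s t : AlgState S}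
    {l : List (RuleApp S)} (h : Steps (Iteration P Cls) s l t) (hs : IsDefSystem Cls s.defs) :
    IsDefSystem Cls t.defs := by
  induction h with
  | refl => exact hs
  | step h _ ih => exact ih (h.isDefSystem hs)

theorem iterations_defs_subset {P : Params S} {Cls : Set (Clause S)} {s t : AlgState S}
    {l : List (RuleApp S)} (h : Steps (Iteration P Cls) s l t) : s.defs ⊆ t.defs := by
  induction h with
  | refl => exact subset_rfl
  | step h _ ih => exact h.defs_subset.trans ih

theorem iterations_isModel {P : Params S} {Cls All : Set (Clause S)} (hsat : Satisfiable Cls)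
    (hAll : IsDefSystem Cls All) {s t : AlgState S} {l : List (RuleApp S)}
    (h : Steps (Iteration P Cls) s l t) (hsub : t.defs ⊆ All)
    (hE : ∀ a ∈ l, a.IsFold → a.FulfillsE) (hF : ∀ a ∈ l, ¬ a.IsFold → a.FulfillsF (definite Cls))
    (hs : IsModel (defModel Cls All) (s.inCls ∪ s.transfCls)) :
    IsModel (defModel Cls All) (t.inCls ∪ t.transfCls) := by
  induction h with
  | refl => exact hs
  | step h h' ih =>
    refine ih hsub (fun a ha => hE a (List.mem_append_right _ ha))
      (fun a ha => hF a (List.mem_append_right _ ha)) ?_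
    exact h.isModel hsat hAll ((iterations_defs_subset h').trans hsub)
      (fun a ha => hE a (List.mem_append_left _ ha))
      (fun a ha => hF a (List.mem_append_left _ ha)) hs

end CHC

end

/-- Completeness of the ADT removal algorithm. -/
theorem theorem8 (S : CHC.Signature) (hS : ∀ a : S.Adt, Nonempty (CHC.Value S (.adt a)))
    (P : CHC.Params S) (Cls TransfCls : Set (CHC.Clause S)) (apps : List (CHC.RuleApp S))
    (hrun : CHC.AlgorithmR P Cls apps TransfCls)
    (hE : ∀ a ∈ apps, a.IsFold → a.FulfillsE)
    (hF : ∀ a ∈ apps, ¬ a.IsFold → a.FulfillsF (CHC.definite Cls))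
    (hsat : CHC.Satisfiable Cls) :
    CHC.Satisfiable TransfCls := by
  obtain ⟨Defs, hsteps⟩ := hrun
  have hAll : CHC.IsDefSystem Cls Defs :=
    CHC.iterations_isDefSystem hsteps (CHC.IsDefSystem.empty Cls)
  -- The model is built from the definitions of the completed run, so it serves every earlier stage.
  refine ⟨CHC.defModel Cls Defs, fun C hC => ?_⟩
  refine CHC.iterations_isModel hsat hAll hsteps subset_rfl hE hF ?_ C (.inr hC)
  rintro D (hD | hD)
  exacts [CHC.isModel_defModel hsat hAll D (.inl hD.1), hD.elim]
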